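/- A \emph{discrete filtered set} (d.f.s.) is a family $\Omega=(\Omega_L)_{L\in\mathbb R_{\ge0}}$ of finite subsets of $\mathbb C$ such that $\Omega_{L_1}\subseteq\Omega_{L_2}$ whenever $L_1\le L_2$, and $\Omega_\delta=\emptyset$ for some $\delta>0$. The \emph{sum} $\Omega*\Omega'$ of two d.f.s. is the d.f.s. defined by \[ (\Omega*\Omega')_L=\{\omega_1+\omega_2 \mid \omega_1\in\Omega_{L_1},\ \omega_2\in\Omega'_{L_2},\ L_1,L_2\ge0,\ L_1+L_2=L\}\cup\Omega_L\cup\Omega'_L ; \] this law is commutative and associative. With $\Omega^{*n}=\Omega*\cdots*\Omega$ ($n$ times), $\Omega^{*\infty}$ is the d.f.s. defined by $(\Omega^{*\infty})_L=\bigcup_{n\ge1}(\Omega^{*n})_L$. For a d.f.s. $\Omega$, let $\mathcal M_\Omega$ be the complement in $\mathbb R_{\ge0}\times\mathbb C$ of the closure of $\{(\lambda,\omega)\in\mathbb R_{\ge0}\times\mathbb C\mid\omega\in\Omega_\lambda\}$. A Lipschitz path $\gamma:[0,t_*]\to\mathbb C$ ($t_*\ge0$) with $\gamma(0)=0$ is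 \emph{$\Omega$-allowed} if $(L(\gamma_{|t}),\gamma(t))\in\mathcal M_\Omega$ for all $t\in[0,t_*]$, where $L(\gamma_{|t})$ is the length of the restriction of $\gamma$ to $[0,t]$. A convergent power series $\hat\varphi\in\mathbb C\{\zeta\}$ is \emph{$\Omega$-continuable} if it can be analytically continued along every $\Omega$-allowed path. A formal series $\tilde\varphi=\sum_{j\ge0}\varphi_jz^j\in\mathbb C[[z]]$ is \emph{$\Omega$-resurgent} if its formal Borel transform $\hat\varphi(\zeta)=\sum_{j\ge1}\varphi_j\frac{\zeta^{j-1}}{(j-1)!}$ (the term $\varphi_0$ being disregarded) is a convergent power series which is $\Omega$-continuable. The set of $\Omega$-resurgent series is denoted by $\mathscr R_\Omega$. \textbf{Theorem.} Let $r\ge1$ be an integer and let $\Omega_1,\dots,\Omega_r$ be d.f.s. Then, for any convergent power series $F(w_1,\dots,w_r)=\sum_{k\in\mathbb N^r}c_k\,w_1^{k_1}\cdots w_r^{k_r}\in\mathbb C\{w_1,\dots,w_r\}$ and for any $\tilde\varphi_1,\dots,\tilde\varphi_r\in\mathbb C[[z]]$ without constant term, \[ \tilde\varphi_1\in\mathscr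 R_{\Omega_1},\ \dots,\ \tilde\varphi_r\in\mathscr R_{\Omega_r} \quad\Longrightarrow\quad F(\tilde\varphi_1,\dots,\tilde\varphi_r)=\sum_{k\in\mathbb N^r}c_k\,\tilde\varphi_1^{k_1}\cdots\tilde\varphi_r^{k_r}\in\mathscr R_{\Omega^*}, \] where $\Omega^*=(\Omega_1*\cdots*\Omega_r)^{*\infty}$. -/

import Mathlib

open scoped NNReal Topology

noncomputable section

namespace Resurgence

/-- A discrete filtered set: a nondecreasing family `(Ω_L)_{L ≥ 0}` of finite subsets of `ℂ`
such that `Ω_δ = ∅` for some `δ > 0`. -/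
@[ext]
structure DFS where
  carrier : ℝ≥0 → Set ℂ
  finite' : ∀ L, (carrier L).Finite
  mono' : ∀ L₁ L₂, L₁ ≤ L₂ → carrier L₁ ⊆ carrier L₂
  empty' : ∃ δ : ℝ≥0, 0 < δ ∧ carrier δ = ∅

namespace DFS

/-- The family `(Ω * Ω')_L`, for arbitrary families of subsets of `ℂ`. -/
def sumCarrier (A B : ℝ≥0 → Set ℂ) (L : ℝ≥0) : Set ℂ :=
  {ω | ∃ L₁ L₂ : ℝ≥0, L₁ + L₂ = L ∧ ∃ ω₁ ∈ A L₁, ∃ ω₂ ∈ B L₂, ω = ω₁ + ω₂} ∪ A L ∪ B L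

/-- The sum of two discrete filtered sets, written `Ω * Ω'`. -/
instance : Mul DFS where
  mul Ω Ω' :=
    { carrier := sumCarrier Ω.carrier Ω'.carrier
      finite' := by
        intro L
        refine (Set.Finite.union ?_ (Ω.finite' L)).union (Ω'.finite' L)
        refine (Set.Finite.image2 (fun x y => x + y) (Ω.finite' L) (Ω'.finite' L)).subset ?_
        rintro ω ⟨L₁, L₂, h, ω₁, h₁, ω₂, h₂, rfl⟩
        exact ⟨ω₁, Ω.mono' L₁ L (h ▸ le_self_add) h₁, ω₂, Ω'.mono' L₂ L (h ▸ le_add_self) h₂, rfl⟩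
      mono' := by
        rintro L L' hL ω ((⟨L₁, L₂, h, ω₁, h₁, ω₂, h₂, rfl⟩ | h) | h)
        · obtain ⟨d, rfl⟩ := exists_add_of_le hL
          refine Or.inl (Or.inl ⟨L₁, L₂ + d, by rw [← h, add_assoc], ω₁, h₁, ω₂, ?_, rfl⟩)
          exact Ω'.mono' L₂ _ le_self_add h₂
        · exact Or.inl (Or.inr (Ω.mono' L L' hL h))
        · exact Or.inr (Ω'.mono' L L' hL h)
      empty' := by
        obtain ⟨δ, hδ, e⟩ := Ω.empty'
        obtain ⟨δ', hδ', e'⟩ := Ω'.empty'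
        have key : ∀ x ≤ min δ δ', Ω.carrier x = ∅ ∧ Ω'.carrier x = ∅ := fun x hx =>
          ⟨Set.subset_empty_iff.1 (e ▸ Ω.mono' x δ (hx.trans (min_le_left _ _))),
            Set.subset_empty_iff.1 (e' ▸ Ω'.mono' x δ' (hx.trans (min_le_right _ _)))⟩
        refine ⟨min δ δ', lt_min hδ hδ', Set.subset_empty_iff.1 ?_⟩
        rintro ω ((⟨L₁, L₂, h, ω₁, h₁, -⟩ | h) | h)
        · rwa [(key L₁ (h ▸ le_self_add)).1] at h₁
        · rwa [(key _ le_rfl).1] at h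
        · rwa [(key _ le_rfl).2] at h }

/-- The trivial discrete filtered set, all of whose members are empty: the unit for `*`. -/
instance : One DFS where
  one :=
    { carrier := fun _ => ∅
      finite' := fun _ => Set.finite_empty
      mono' := fun _ _ _ => subset_rfl
      empty' := ⟨1, one_pos, rfl⟩ }

theorem mem_mul {Ω Ω' : DFS} {L : ℝ≥0} {ω : ℂ} :
    ω ∈ (Ω * Ω').carrier L ↔
      (∃ L₁ L₂ : ℝ≥0, L₁ + L₂ = L ∧ ∃ ω₁ ∈ Ω.carrier L₁, ∃ ω₂ ∈ Ω'.carrier L₂, ω = ω₁ + ω₂) ∨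
        ω ∈ Ω.carrier L ∨ ω ∈ Ω'.carrier L :=
  or_assoc

theorem notMem_one {L : ℝ≥0} {ω : ℂ} : ω ∉ (1 : DFS).carrier L := fun h => h

theorem mul_comm' (Ω Ω' : DFS) : Ω * Ω' = Ω' * Ω := by
  have key : ∀ (A B : DFS) (L : ℝ≥0) (ω : ℂ), ω ∈ (A * B).carrier L → ω ∈ (B * A).carrier L := by
    intro A B L ω h
    rw [mem_mul] at h ⊢
    rcases h with ⟨L₁, L₂, h, ω₁, h₁, ω₂, h₂, rfl⟩ | h | h
    · exact Or.inl ⟨L₂, L₁, by rw [← h, add_comm], ω₂, h₂, ω₁, h₁, add_comm _ _⟩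
    · exact Or.inr (Or.inr h)
    · exact Or.inr (Or.inl h)
  ext L ω
  exact ⟨key _ _ _ _, key _ _ _ _⟩

theorem one_mul' (Ω : DFS) : 1 * Ω = Ω := by
  ext L ω
  rw [mem_mul]
  simp [notMem_one]

theorem mul_assoc_aux {A B C : DFS} {L : ℝ≥0} {ω : ℂ} (h : ω ∈ (A * B * C).carrier L) :
    ω ∈ (A * (B * C)).carrier L := by
  simp only [mem_mul] at h ⊢
  rcases h with ⟨L₁, L₂, rfl, x, hx, c, hc, rfl⟩ | h | h
  · rcases hx with ⟨M₁, M₂, rfl, a, ha, b, hb, rfl⟩ | hx | hx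
    · exact Or.inl ⟨M₁, M₂ + L₂, (add_assoc _ _ _).symm, a, ha, b + c,
        Or.inl ⟨M₂, L₂, rfl, b, hb, c, hc, rfl⟩, add_assoc _ _ _⟩
    · exact Or.inl ⟨L₁, L₂, rfl, x, hx, c, Or.inr (Or.inr hc), rfl⟩
    · exact Or.inr (Or.inr (Or.inl ⟨L₁, L₂, rfl, x, hx, c, hc, rfl⟩))
  · rcases h with ⟨M₁, M₂, rfl, a, ha, b, hb, rfl⟩ | h | h
    · exact Or.inl ⟨M₁, M₂, rfl, a, ha, b, Or.inr (Or.inl hb), rfl⟩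
    · exact Or.inr (Or.inl h)
    · exact Or.inr (Or.inr (Or.inr (Or.inl h)))
  · exact Or.inr (Or.inr (Or.inr (Or.inr h)))

/-- The sum of discrete filtered sets is commutative and associative, with the trivial one as
unit; `Ω ^ n` is the `n`-fold sum `Ω * ⋯ * Ω`. -/
instance : CommMonoid DFS where
  mul_assoc A B C := by
    ext L ω
    refine ⟨mul_assoc_aux, fun h => ?_⟩
    rw [mul_comm' A, mul_comm' B] at h
    rw [mul_comm' (A * B), mul_comm' A]
    exact mul_assoc_aux h
  mul_comm := mul_comm'
  one_mul := one_mul'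
  mul_one Ω := by rw [mul_comm', one_mul']

open scoped Pointwise in
theorem pow_subset (Ω : DFS) {δ : ℝ≥0} (hδ : Ω.carrier δ = ∅) (n : ℕ) (L : ℝ≥0) (ω : ℂ)
    (h : ω ∈ (Ω ^ n).carrier L) : ∃ k : ℕ, 1 ≤ k ∧ k * δ ≤ L ∧ ω ∈ k • Ω.carrier L := by
  have hlt : ∀ (M : ℝ≥0) (x : ℂ), x ∈ Ω.carrier M → δ ≤ M := by
    intro M x hx
    by_contra hM
    have := Ω.mono' M δ (not_le.1 hM).le hx
    rwa [hδ] at this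
  induction n generalizing L ω with
  | zero => exact absurd h (by rw [pow_zero]; exact notMem_one)
  | succ n ih =>
    rw [pow_succ, mem_mul] at h
    rcases h with ⟨L₁, L₂, rfl, x, hx, y, hy, rfl⟩ | h | h
    · obtain ⟨k, hk, hkL, hxk⟩ := ih L₁ x hx
      refine ⟨k + 1, by omega, ?_, ?_⟩
      · push_cast
        rw [add_mul, one_mul]
        exact add_le_add hkL (hlt _ _ hy)
      · rw [succ_nsmul]
        refine Set.add_mem_add ?_ (Ω.mono' _ _ le_add_self hy)
        exact Set.nsmul_subset_nsmul_left (Ω.mono' _ _ le_self_add) hxk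
    · exact ih L ω h
    · exact ⟨1, le_rfl, by simpa using hlt _ _ h, by simpa using h⟩

open scoped Pointwise in
/-- The inductive limit `Ω^{*∞}` of the increasing sequence `Ω^{*n}`, `n ≥ 1`:
`(Ω^{*∞})_L = ⋃_{n ≥ 1} (Ω^{*n})_L`. -/
def iterSum (Ω : DFS) : DFS where
  carrier L := ⋃ n : ℕ, (Ω ^ (n + 1)).carrier L
  finite' := by
    intro L
    obtain ⟨δ, hδ, e⟩ := Ω.empty'
    have hf : ∀ k : ℕ, (k • Ω.carrier L).Finite := by
      intro k
      induction k with
      | zero => rw [zero_nsmul]; exact Set.finite_zero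
      | succ k ih => rw [succ_nsmul]; exact ih.add (Ω.finite' L)
    refine ((Set.finite_Iic ⌊L / δ⌋₊).biUnion (fun k _ => hf k)).subset ?_
    intro ω h
    obtain ⟨n, h⟩ := Set.mem_iUnion.1 h
    obtain ⟨k, -, hk, hω⟩ := pow_subset Ω e _ L ω h
    exact Set.mem_biUnion (Set.mem_Iic.2 (Nat.le_floor ((le_div_iff₀ hδ).2 hk))) hω
  mono' L₁ L₂ h := Set.iUnion_mono fun n => (Ω ^ (n + 1)).mono' L₁ L₂ h
  empty' := by
    obtain ⟨δ, hδ, e⟩ := Ω.empty'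
    refine ⟨δ, hδ, Set.subset_empty_iff.1 ?_⟩
    intro ω h
    obtain ⟨n, h⟩ := Set.mem_iUnion.1 h
    obtain ⟨k, hk, -, hω⟩ := pow_subset Ω e _ δ ω h
    obtain ⟨m, rfl⟩ := Nat.exists_eq_add_of_le' hk
    rwa [e, succ_nsmul, Set.add_empty] at hω

/-- The set `S_Ω` of all `(λ, ω)` with `ω ∈ Ω_λ`. -/
def graph (Ω : DFS) : Set (ℝ≥0 × ℂ) := {p | p.2 ∈ Ω.carrier p.1}

/-- The allowed open set `M_Ω`: the complement of the closure of `S_Ω` in `ℝ≥0 × ℂ`. -/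
def allowed (Ω : DFS) : Set (ℝ≥0 × ℂ) := (closure Ω.graph)ᶜ

end DFS

/-- The set `Π` of Lipschitz paths `γ : [0, t_*] → ℂ` with `γ(0) = 0` and `t_* ≥ 0`.
The values of `toFun` outside `[0, t_*]` are irrelevant. -/
structure LipPath where
  toFun : ℝ → ℂ
  tEnd : ℝ
  tEnd_nonneg : 0 ≤ tEnd
  lipschitz : ∃ K : ℝ≥0, LipschitzOnWith K toFun (Set.Icc 0 tEnd)
  map_zero : toFun 0 = 0

/-- The length `L(γ_{|t})` of the restriction of `γ` to `[0, t]`; this total variation is finite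
for `0 ≤ t ≤ t_*`, since `γ` is Lipschitz. -/
def LipPath.lengthUpTo (γ : LipPath) (t : ℝ) : ℝ≥0 :=
  (eVariationOn γ.toFun (Set.Icc 0 t)).toNNReal

/-- `Ω`-allowed paths. -/
def LipPath.IsAllowed (γ : LipPath) (Ω : DFS) : Prop :=
  ∀ t ∈ Set.Icc 0 γ.tEnd, (γ.lengthUpTo t, γ.toFun t) ∈ Ω.allowed

/-- The germ of `f` at `0` can be analytically continued along `γ`: there are holomorphic germs
`g t` at `γ t`, starting with the germ of `f`, such that for `s` close to `t` the germ `g s` is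
the one induced at `γ s` by `g t`. -/
def ContinuableAlong (f : ℂ → ℂ) (γ : LipPath) : Prop :=
  ∃ g : ℝ → ℂ → ℂ,
    (∀ t ∈ Set.Icc 0 γ.tEnd, AnalyticAt ℂ (g t) (γ.toFun t)) ∧
    g 0 =ᶠ[𝓝 0] f ∧
    ∀ t ∈ Set.Icc 0 γ.tEnd, ∀ᶠ s in 𝓝[Set.Icc 0 γ.tEnd] t, g s =ᶠ[𝓝 (γ.toFun s)] g t

/-- The set of `Ω`-continuable functions: the power series with positive radius of convergence
whose sum near `0` can be analytically continued along every `Ω`-allowed path. -/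
def continuable (Ω : DFS) : Set (PowerSeries ℂ) :=
  {φ | ∃ f : ℂ → ℂ,
    HasFPowerSeriesAt f
      (FormalMultilinearSeries.ofScalars ℂ fun n => PowerSeries.coeff n φ) 0 ∧
    ∀ γ : LipPath, γ.IsAllowed Ω → ContinuableAlong f γ}

/-- The formal Borel transform `∑ φ_j z^j ↦ φ_0 δ + ∑_{j ≥ 1} φ_j ζ^{j-1} / (j-1)!`; an element
`c δ + ψ` of `ℂ δ ⊕ ℂ[[ζ]]` is represented by the pair `(c, ψ)`. -/
def borel (φ : PowerSeries ℂ) : ℂ × PowerSeries ℂ :=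
  (PowerSeries.constantCoeff φ,
    PowerSeries.mk fun n => PowerSeries.coeff (n + 1) φ / (n.factorial : ℂ))

/-- The set of `Ω`-resurgent series: the preimage by the Borel transform of the direct sum of
`ℂ δ` and of the `Ω`-continuable functions. -/
def resurgent (Ω : DFS) : Set (PowerSeries ℂ) :=
  borel ⁻¹' (Set.univ ×ˢ continuable Ω)

/-- `F` is a convergent power series in `r` variables: it converges absolutely on some polydisc
centred at the origin. -/
def IsConvergent {r : ℕ} (F : MvPowerSeries (Fin r) ℂ) : Prop :=
  ∃ ρ : ℝ, 0 < ρ ∧ Summable fun k : Fin r →₀ ℕ => ‖MvPowerSeries.coeff k F‖ * ρ ^ k.degree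

end Resurgence

end

/-!
Let `φ̂ i` be the Borel transform of `φ i`. The Borel transform turns products into convolutions,
so that of `F(φ)` is a series in convolution products of the `φ̂ i`; all of these are encoded at
once by a linear Volterra equation. Let the bounded operators `shift i` act on bounded families
of coefficients indexed by monomials: `shift i` divides by the `i`-th variable the monomials of
which this is the first variable, and kills the others. With `f = ∑ i, φ̂ i • shift i`, the
resolvent `χ = f + χ * f` takes values in a Banach algebra, and the Borel transform of `F(φ)` is
the image of `χ` under a continuous linear form.

It remains to continue `χ` along a path `γ` that is allowed for `Ω^{*∞}`, where `Ω` is the sum of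
the `Ω i`. The segment from `0` to `γ(t)` is deformed into a contour `H_t` from `0` to `γ(t)` by
a flow which is slowed down near the singular points of `f`, so that `H_t` can serve as an
allowed path for `f`. Since adding a singular point of `f` to one of `χ` gives a singular point
of `χ`, the difference `γ(t) - H_t(s)` avoids those of `χ` when it moves at all, and `χ * f` is
continued by the integral over `H_t`. Everything is discretised: paths are replaced by fine
chains of points, contours by polygons, and at each step of time the germ at the new end point
solves a Volterra equation whose inhomogeneous term involves only germs known already.
-/

noncomputable section

namespace Resurgence

open Set Metric Filter Function
open scoped Interval NNReal Topology

section SegmentIntegral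

theorem add_mul_sub_mem_of_convex {U : Set ℂ} (hU : Convex ℝ U) {a b : ℂ} (ha : a ∈ U)
    (hb : b ∈ U) {s : ℝ} (hs : s ∈ Icc (0 : ℝ) 1) : a + s * (b - a) ∈ U := by
  simpa using hU.add_smul_sub_mem ha hb hs

theorem hasDerivAt_intervalIntegral_of_continuousOn {𝕜 E : Type*} [RCLike 𝕜]
    [NormedAddCommGroup E] [NormedSpace ℝ E] [NormedSpace 𝕜 E] {F F' : 𝕜 → ℝ → E} {a b : ℝ}
    (hab : a ≤ b) {U : Set 𝕜} (hU : IsOpen U) (hF : ContinuousOn (uncurry F) (U ×ˢ Icc a b))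
    (hF' : ContinuousOn (uncurry F') (U ×ˢ Icc a b))
    (hd : ∀ z ∈ U, ∀ s ∈ Icc a b, HasDerivAt (F · s) (F' z s) z) {z : 𝕜} (hz : z ∈ U) :
    HasDerivAt (fun z => ∫ s in a..b, F z s) (∫ s in a..b, F' z s) z := by
  have section_integrable : ∀ {G : 𝕜 → ℝ → E}, ContinuousOn (uncurry G) (U ×ˢ Icc a b) →
      ∀ w ∈ U, IntervalIntegrable (G w) MeasureTheory.volume a b := fun {G} hG w hw =>
    ContinuousOn.intervalIntegrable_of_Icc hab <|
      hG.comp (f := fun s : ℝ => (w, s)) (by fun_prop) fun s hs => ⟨hw, hs⟩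
  obtain ⟨R, hR, hRU⟩ := nhds_basis_closedBall.mem_iff.1 (hU.mem_nhds hz)
  obtain ⟨M, hM⟩ := ((isCompact_closedBall z R).prod
    (isCompact_Icc (a := a) (b := b))).exists_bound_of_continuousOn
      (hF'.mono (prod_mono hRU subset_rfl))
  have hIcc : Ι a b ⊆ Icc a b := uIcc_of_le hab ▸ uIoc_subset_uIcc
  refine (intervalIntegral.hasDerivAt_integral_of_dominated_loc_of_deriv_le
    (bound := fun _ => M) (ball_mem_nhds z hR) ?_ (section_integrable hF z hz)
    (section_integrable hF' z hz).aestronglyMeasurable_restrict_uIoc ?_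
    intervalIntegrable_const ?_).2
  · filter_upwards [hU.mem_nhds hz] with w hw
      using (section_integrable hF w hw).aestronglyMeasurable_restrict_uIoc
  · exact .of_forall fun s hs w hw => hM (w, s) ⟨ball_subset_closedBall hw, hIcc hs⟩
  · exact .of_forall fun s hs w hw => hd w (hRU (ball_subset_closedBall hw)) s (hIcc hs)

variable {E : Type*} [NormedAddCommGroup E] [NormedSpace ℂ E]

/-- The integral of `Φ` along the segment from `a` to `b` in the complex plane. -/
def segmentIntegral (Φ : ℂ → E) (a b : ℂ) : E :=
  ∫ s in (0 : ℝ)..1, (b - a) • Φ (a + s * (b - a))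

theorem segmentIntegral_self (Φ : ℂ → E) (a : ℂ) : segmentIntegral Φ a a = 0 := by
  simp [segmentIntegral]

theorem segmentIntegral_congr {Φ Ψ : ℂ → E} {U : Set ℂ} (hU : Convex ℝ U) {a b : ℂ}
    (ha : a ∈ U) (hb : b ∈ U) (h : EqOn Φ Ψ U) :
    segmentIntegral Φ a b = segmentIntegral Ψ a b := by
  refine intervalIntegral.integral_congr fun s hs => ?_
  rw [uIcc_of_le zero_le_one] at hs
  rw [h (add_mul_sub_mem_of_convex hU ha hb hs)]

theorem norm_segmentIntegral_le {Φ : ℂ → E} {a b : ℂ} {M : ℝ}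
    (h : ∀ s ∈ Icc (0 : ℝ) 1, ‖Φ (a + s * (b - a))‖ ≤ M) :
    ‖segmentIntegral Φ a b‖ ≤ ‖b - a‖ * M := by
  suffices ‖segmentIntegral Φ a b‖ ≤ ‖b - a‖ * M * |(1 : ℝ) - 0| by simpa using this
  refine intervalIntegral.norm_integral_le_of_norm_le_const fun s hs => ?_
  rw [uIoc_of_le zero_le_one] at hs
  rw [norm_smul]
  gcongr
  exact h s (Ioc_subset_Icc_self hs)

variable [CompleteSpace E]

theorem exists_primitive_segmentIntegral {Φ : ℂ → E} {c : ℂ} {R : ℝ}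
    (h : DifferentiableOn ℂ Φ (ball c R)) :
    ∃ Q : ℂ → E, ∀ a ∈ ball c R, ∀ b ∈ ball c R, segmentIntegral Φ a b = Q b - Q a := by
  obtain ⟨Q, hQ⟩ := h.isExactOn_ball
  refine ⟨Q, fun a ha b hb => ?_⟩
  have hmem : ∀ s ∈ Icc (0 : ℝ) 1, a + s * (b - a) ∈ ball c R := fun s hs =>
    add_mul_sub_mem_of_convex (convex_ball c R) ha hb hs
  have hderiv : ∀ s ∈ uIcc (0 : ℝ) 1, HasDerivAt (fun s : ℝ => Q (a + s * (b - a)))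
      ((b - a) • Φ (a + s * (b - a))) s := by
    intro s hs
    rw [uIcc_of_le zero_le_one] at hs
    have hseg : HasDerivAt (fun s : ℝ => a + (s : ℂ) * (b - a)) (b - a) s := by
      simpa using ((Complex.ofRealCLM.hasDerivAt (x := s)).mul_const (b - a)).const_add a
    exact (hQ _ (hmem s hs)).scomp s hseg
  have hcont : ContinuousOn (fun s : ℝ => (b - a) • Φ (a + s * (b - a))) (Icc 0 1) :=
    (h.continuousOn.comp (by fun_prop) hmem).const_smul _
  rw [segmentIntegral, intervalIntegral.integral_eq_sub_of_hasDerivAt hderiv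
    (hcont.intervalIntegrable_of_Icc zero_le_one)]
  simp

end SegmentIntegral

section Convolution

variable {A : Type*} [NormedRing A] {X Y V : ℂ → A} {c z : ℂ} {R : ℝ}

theorem segment_mem_ball (hz : z ∈ ball c R) {s : ℝ} (hs : s ∈ Icc (0 : ℝ) 1) :
    c + s * (z - c) ∈ ball c R :=
  add_mul_sub_mem_of_convex (convex_ball c R) (mem_ball_self (pos_of_mem_ball hz)) hz hs

theorem segment_mem_closedBall (c z : ℂ) {s : ℝ} (hs : s ∈ Icc (0 : ℝ) 1) :
    c + s * (z - c) ∈ closedBall c ‖z - c‖ :=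
  add_mul_sub_mem_of_convex (convex_closedBall c _) (mem_closedBall_self (norm_nonneg _))
    (by simp [dist_eq_norm]) hs

theorem sub_segment_mem_ball_zero (hz : z ∈ ball c R) {s : ℝ} (hs : s ∈ Icc (0 : ℝ) 1) :
    z - (c + s * (z - c)) ∈ ball (0 : ℂ) R := by
  have h : z - (c + s * (z - c)) = ((1 - s : ℝ) : ℂ) * (z - c) := by
    push_cast
    ring
  rw [mem_ball_zero_iff, h, norm_mul, Complex.norm_real, Real.norm_of_nonneg (by linarith [hs.2])]
  exact (mul_le_of_le_one_left (norm_nonneg _) (by linarith [hs.1])).trans_lt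
    (mem_ball_iff_norm.1 hz)

/-- The integrand `X(u) V(z - u)` of the convolution of `X` and `V`, at the point
`u = c + s (z - c)` of the segment from `c` to `z`. -/
def convKernel (c : ℂ) (X V : ℂ → A) (z : ℂ) (s : ℝ) : A :=
  X (c + s * (z - c)) * V (z - (c + s * (z - c)))

theorem continuousOn_convKernel (hX : ContinuousOn X (ball c R)) (hV : ContinuousOn V (ball 0 R)) :
    ContinuousOn (uncurry (convKernel c X V)) (ball c R ×ˢ Icc 0 1) :=
  (hX.comp (f := fun p : ℂ × ℝ => c + p.2 * (p.1 - c)) (by fun_prop)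
      fun _ hp => segment_mem_ball hp.1 hp.2).mul
    (hV.comp (f := fun p : ℂ × ℝ => p.1 - (c + p.2 * (p.1 - c))) (by fun_prop)
      fun _ hp => sub_segment_mem_ball_zero hp.1 hp.2)

theorem norm_convKernel_le {B M : ℝ} (hz : z ∈ ball c R) {s : ℝ} (hs : s ∈ Icc (0 : ℝ) 1)
    (hX : ‖X (c + s * (z - c))‖ ≤ B) (hV : ∀ u ∈ ball (0 : ℂ) R, ‖V u‖ ≤ M) :
    ‖convKernel c X V z s‖ ≤ B * M :=
  (norm_mul_le _ _).trans (mul_le_mul hX (hV _ (sub_segment_mem_ball_zero hz hs))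
    (norm_nonneg _) ((norm_nonneg _).trans hX))

variable [NormedAlgebra ℂ A]

/-- The convolution integral `∫_c^z X(u) V(z - u) du` along a segment, for `X` defined near `c` and
`V` defined near `0`. -/
def convFrom (c : ℂ) (X V : ℂ → A) (z : ℂ) : A :=
  segmentIntegral (fun u => X u * V (z - u)) c z

theorem convFrom_eq_integral_convKernel (c : ℂ) (X V : ℂ → A) (z : ℂ) :
    convFrom c X V z = ∫ s in (0 : ℝ)..1, (z - c) • convKernel c X V z s := rfl

theorem convFrom_self (c : ℂ) (X V : ℂ → A) : convFrom c X V c = 0 := segmentIntegral_self _ _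

theorem convFrom_congr_eventually (h : X =ᶠ[𝓝 c] Y) : convFrom c X V =ᶠ[𝓝 c] convFrom c Y V := by
  obtain ⟨r, hr, hXY⟩ := Metric.eventually_nhds_iff_ball.1 h
  filter_upwards [ball_mem_nhds c hr] with z hz
  refine segmentIntegral_congr (convex_ball c r) (mem_ball_self hr) hz fun u hu => ?_
  simp only [hXY u hu]

theorem intervalIntegrable_smul_convKernel (hX : ContinuousOn X (ball c R))
    (hV : ContinuousOn V (ball 0 R)) (hz : z ∈ ball c R) :
    IntervalIntegrable (fun s => (z - c) • convKernel c X V z s) MeasureTheory.volume 0 1 :=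
  ContinuousOn.intervalIntegrable_of_Icc zero_le_one <|
    ((continuousOn_convKernel hX hV).comp (f := fun s : ℝ => (z, s)) (by fun_prop)
      fun _ hs => ⟨hz, hs⟩).const_smul (z - c)

theorem convFrom_sub (hX : ContinuousOn X (ball c R)) (hY : ContinuousOn Y (ball c R))
    (hV : ContinuousOn V (ball 0 R)) (hz : z ∈ ball c R) :
    convFrom c (X - Y) V z = convFrom c X V z - convFrom c Y V z := by
  simp only [convFrom_eq_integral_convKernel]
  rw [← intervalIntegral.integral_sub (intervalIntegrable_smul_convKernel hX hV hz)
    (intervalIntegrable_smul_convKernel hY hV hz)]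
  simp only [convKernel, Pi.sub_apply, sub_mul, smul_sub]

theorem norm_convFrom_le {B M : ℝ} (hz : z ∈ ball c R)
    (hX : ∀ u ∈ closedBall c ‖z - c‖, ‖X u‖ ≤ B) (hV : ∀ u ∈ ball (0 : ℂ) R, ‖V u‖ ≤ M) :
    ‖convFrom c X V z‖ ≤ ‖z - c‖ * (B * M) :=
  norm_segmentIntegral_le fun _ hs =>
    norm_convKernel_le hz hs (hX _ (segment_mem_closedBall c z hs)) hV

theorem hasSum_convFrom {K : ℕ → ℂ → A} {b : ℕ → ℝ} {M : ℝ}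
    (hK : ∀ n, ContinuousOn (K n) (ball c R)) (hVc : ContinuousOn V (ball 0 R))
    (hz : z ∈ ball c R) (hb : ∀ n, ∀ u ∈ closedBall c ‖z - c‖, ‖K n u‖ ≤ b n)
    (hsum : Summable b) (hV : ∀ u ∈ ball (0 : ℂ) R, ‖V u‖ ≤ M) [CompleteSpace A] :
    HasSum (fun n => convFrom c (K n) V z) (convFrom c (fun u => ∑' n, K n u) V z) := by
  have hIcc : Ι (0 : ℝ) 1 ⊆ Icc 0 1 := uIcc_of_le (zero_le_one' ℝ) ▸ uIoc_subset_uIcc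
  refine intervalIntegral.hasSum_integral_of_dominated_convergence
    (bound := fun n _ => ‖z - c‖ * (b n * M))
    (fun n =>
      (intervalIntegrable_smul_convKernel (hK n) hVc hz).aestronglyMeasurable_restrict_uIoc)
    (fun n => .of_forall fun s hs => ?_)
    (.of_forall fun _ _ => (hsum.mul_right M).mul_left _) intervalIntegrable_const
    (.of_forall fun s hs => ?_)
  · rw [norm_smul]
    exact mul_le_mul_of_nonneg_left (norm_convKernel_le hz (hIcc hs)
      (hb n _ (segment_mem_closedBall c z (hIcc hs))) hV) (norm_nonneg _)
  · have hKs : Summable fun n => K n (c + s * (z - c)) :=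
      .of_norm_bounded hsum fun n => hb n _ (segment_mem_closedBall c z (hIcc hs))
    exact (hKs.hasSum.mul_right _).const_smul _

theorem hasDerivAt_convKernel (hX : DifferentiableOn ℂ X (ball c R))
    (hV : DifferentiableOn ℂ V (ball 0 R)) (hz : z ∈ ball c R) {s : ℝ} (hs : s ∈ Icc (0 : ℝ) 1) :
    HasDerivAt (fun z => convKernel c X V z s)
      ((s : ℂ) • convKernel c (deriv X) V z s + (1 - s : ℂ) • convKernel c X (deriv V) z s) z := by
  have hXs := (hX.differentiableAt (isOpen_ball.mem_nhds (segment_mem_ball hz hs))).hasDerivAt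
  have hVs := (hV.differentiableAt
    (isOpen_ball.mem_nhds (sub_segment_mem_ball_zero hz hs))).hasDerivAt
  have hu : HasDerivAt (fun w : ℂ => c + (s : ℂ) * (w - c)) (s : ℂ) z := by
    simpa using (((hasDerivAt_id z).sub_const c).const_mul (s : ℂ)).const_add c
  refine ((hXs.scomp z hu).mul (hVs.scomp z ((hasDerivAt_id' z).sub hu))).congr_deriv ?_
  simp only [comp_apply, Pi.sub_apply, convKernel, smul_mul_assoc, mul_smul_comm]

theorem hasDerivAt_convKernel_param (hX : DifferentiableOn ℂ X (ball c R))
    (hV : DifferentiableOn ℂ V (ball 0 R)) (hz : z ∈ ball c R) {s : ℝ} (hs : s ∈ Icc (0 : ℝ) 1) :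
    HasDerivAt (convKernel c X V z)
      ((z - c) • (convKernel c (deriv X) V z s - convKernel c X (deriv V) z s)) s := by
  have hXs := (hX.differentiableAt (isOpen_ball.mem_nhds (segment_mem_ball hz hs))).hasDerivAt
  have hVs := (hV.differentiableAt
    (isOpen_ball.mem_nhds (sub_segment_mem_ball_zero hz hs))).hasDerivAt
  have hu : HasDerivAt (fun s : ℝ => c + (s : ℂ) * (z - c)) (z - c) s := by
    simpa using ((Complex.ofRealCLM.hasDerivAt (x := s)).mul_const (z - c)).const_add c
  refine ((hXs.scomp s hu).mul (hVs.scomp s (hu.const_sub z))).congr_deriv ?_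
  simp only [comp_apply, convKernel, smul_mul_assoc, mul_smul_comm]
  module

variable [CompleteSpace A]

theorem hasDerivAt_convFrom (hX : DifferentiableOn ℂ X (ball c R))
    (hV : DifferentiableOn ℂ V (ball 0 R)) (hz : z ∈ ball c R) :
    HasDerivAt (convFrom c X V) (X z * V 0 + convFrom c X (deriv V) z) z := by
  have hX' := (hX.deriv isOpen_ball).continuousOn
  have hV' := (hV.deriv isOpen_ball).continuousOn
  let D : ℂ → ℝ → A := fun w s =>
    (s : ℂ) • convKernel c (deriv X) V w s + (1 - s : ℂ) • convKernel c X (deriv V) w s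
  have hD : ContinuousOn (uncurry D) (ball c R ×ˢ Icc 0 1) :=
    (ContinuousOn.smul (f := fun p : ℂ × ℝ => (p.2 : ℂ)) (by fun_prop)
      (continuousOn_convKernel hX' hV.continuousOn)).add
    (ContinuousOn.smul (f := fun p : ℂ × ℝ => (1 - p.2 : ℂ)) (by fun_prop)
      (continuousOn_convKernel hX.continuousOn hV'))
  have hK := continuousOn_convKernel hX.continuousOn hV.continuousOn
  let I' : ℂ → ℝ → A := fun w s => (w - c) • D w s + convKernel c X V w s
  have hI' : ContinuousOn (uncurry I') (ball c R ×ˢ Icc 0 1) :=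
    (ContinuousOn.smul (f := fun p : ℂ × ℝ => p.1 - c) (by fun_prop) hD).add hK
  have hderiv : HasDerivAt (convFrom c X V) (∫ s in (0 : ℝ)..1, I' z s) z := by
    refine hasDerivAt_intervalIntegral_of_continuousOn zero_le_one isOpen_ball
      (ContinuousOn.smul (f := fun p : ℂ × ℝ => p.1 - c) (by fun_prop) hK) hI' ?_ hz
    intro w hw s hs
    refine (((hasDerivAt_id' w).sub_const c).fun_smul
      (hasDerivAt_convKernel hX hV hw hs)).congr_deriv ?_
    simp only [I', D, one_smul]
  have hI'z : IntervalIntegrable (I' z) MeasureTheory.volume 0 1 :=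
    ContinuousOn.intervalIntegrable_of_Icc zero_le_one <|
      hI'.comp (f := fun s : ℝ => (z, s)) (by fun_prop) fun _ hs => ⟨hz, hs⟩
  have hW := intervalIntegrable_smul_convKernel hX.continuousOn hV' hz
  -- Integration by parts: the remaining integrand is the derivative of `s • convKernel c X V z s`.
  have hparts : ∀ s ∈ uIcc (0 : ℝ) 1, HasDerivAt (fun s : ℝ => (s : ℂ) • convKernel c X V z s)
      (I' z s - (z - c) • convKernel c X (deriv V) z s) s := by
    intro s hs
    rw [uIcc_of_le zero_le_one] at hs
    refine ((Complex.ofRealCLM.hasDerivAt (x := s)).smul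
      (hasDerivAt_convKernel_param hX hV hz hs)).congr_deriv ?_
    simp only [I', D, Complex.ofRealCLM_apply, Complex.ofReal_one]
    module
  refine hderiv.congr_deriv ?_
  rw [← sub_eq_iff_eq_add, convFrom_eq_integral_convKernel, ← intervalIntegral.integral_sub hI'z hW,
    intervalIntegral.integral_eq_sub_of_hasDerivAt hparts (hI'z.sub hW)]
  simp [convKernel]

theorem differentiableOn_convFrom (hX : DifferentiableOn ℂ X (ball c R))
    (hV : DifferentiableOn ℂ V (ball 0 R)) : DifferentiableOn ℂ (convFrom c X V) (ball c R) :=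
  fun _ hz => (hasDerivAt_convFrom hX hV hz).differentiableAt.differentiableWithinAt

theorem differentiableOn_segmentIntegral_mul_sub {a b c : ℂ} {U D : Set ℂ} (hU : IsOpen U)
    (hD : Convex ℝ D) (ha : a ∈ D) (hb : b ∈ D) (hX : ContinuousOn X D)
    (hV : DifferentiableOn ℂ V (ball c R)) (hsub : ∀ z ∈ U, ∀ u ∈ D, z - u ∈ ball c R) :
    DifferentiableOn ℂ (fun z => segmentIntegral (fun u => X u * V (z - u)) a b) U := by
  have hmem : ∀ s ∈ Icc (0 : ℝ) 1, a + s * (b - a) ∈ D := fun s hs =>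
    add_mul_sub_mem_of_convex hD ha hb hs
  have hXs : ContinuousOn (fun p : ℂ × ℝ => X (a + p.2 * (b - a))) (U ×ˢ Icc 0 1) :=
    hX.comp (by fun_prop) fun p hp => hmem _ hp.2
  have hVs : ∀ {W : ℂ → A}, ContinuousOn W (ball c R) →
      ContinuousOn (fun p : ℂ × ℝ => W (p.1 - (a + p.2 * (b - a)))) (U ×ˢ Icc 0 1) := fun hW =>
    hW.comp (by fun_prop) fun p hp => hsub _ hp.1 _ (hmem _ hp.2)
  refine fun z hz => (hasDerivAt_intervalIntegral_of_continuousOn zero_le_one hU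
    (F' := fun z s => (b - a) • (X (a + s * (b - a)) * deriv V (z - (a + s * (b - a)))))
    ((hXs.mul (hVs hV.continuousOn)).const_smul _)
    ((hXs.mul (hVs (hV.deriv isOpen_ball).continuousOn)).const_smul _)
    (fun w hw s hs => ?_) hz).differentiableAt.differentiableWithinAt
  have hVw := hV.differentiableAt (isOpen_ball.mem_nhds (hsub w hw _ (hmem s hs)))
  exact (((hVw.hasDerivAt).comp_sub_const w _).const_mul _).const_smul (b - a)

end Convolution

section Volterra

variable {A : Type*} [NormedRing A] [NormedAlgebra ℂ A] {c : ℂ} {X Y G V : ℂ → A} {R M : ℝ}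

theorem mul_norm_sub_le_of_mem_ball {z : ℂ} (hz : z ∈ ball c R) (hM : 0 ≤ M) :
    ‖z - c‖ * M ≤ R * M :=
  mul_le_mul_of_nonneg_right (mem_ball_iff_norm.1 hz).le hM

theorem eq_zero_of_eq_convFrom (hX : ContinuousOn X (ball c R))
    (hV : ∀ u ∈ ball (0 : ℂ) R, ‖V u‖ ≤ M) (hRM : R * M < 1)
    (h : ∀ z ∈ ball c R, X z = convFrom c X V z) : ∀ z ∈ ball c R, X z = 0 := by
  intro z hz
  have hM : 0 ≤ M := (norm_nonneg _).trans (hV 0 (mem_ball_self (pos_of_mem_ball hz)))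
  have hsub : closedBall c ‖z - c‖ ⊆ ball c R := closedBall_subset_ball (mem_ball_iff_norm.1 hz)
  obtain ⟨w, hw, hmax⟩ := (isCompact_closedBall c ‖z - c‖).exists_isMaxOn
    ⟨c, mem_closedBall_self (norm_nonneg _)⟩ (hX.mono hsub).norm
  have hle : ‖X w‖ ≤ R * M * ‖X w‖ := calc
    ‖X w‖ = ‖convFrom c X V w‖ := by rw [← h w (hsub hw)]
    _ ≤ ‖w - c‖ * (‖X w‖ * M) := norm_convFrom_le (hsub hw) (fun u hu =>
      hmax (closedBall_subset_closedBall (mem_closedBall_iff_norm.1 hw) hu)) hV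
    _ = ‖w - c‖ * M * ‖X w‖ := by ring
    _ ≤ R * M * ‖X w‖ :=
      mul_le_mul_of_nonneg_right (mul_norm_sub_le_of_mem_ball (hsub hw) hM) (norm_nonneg _)
  have hXw : ‖X w‖ ≤ 0 := by nlinarith [norm_nonneg (X w)]
  have hz' : ‖X z‖ ≤ ‖X w‖ := hmax (by simp [dist_eq_norm] : z ∈ closedBall c ‖z - c‖)
  exact norm_le_zero_iff.1 (hz'.trans hXw)

theorem eqOn_of_volterra (hX : ContinuousOn X (ball c R)) (hY : ContinuousOn Y (ball c R))
    (hVc : ContinuousOn V (ball 0 R)) (hV : ∀ u ∈ ball (0 : ℂ) R, ‖V u‖ ≤ M) (hRM : R * M < 1)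
    (eX : ∀ z ∈ ball c R, X z = G z + convFrom c X V z)
    (eY : ∀ z ∈ ball c R, Y z = G z + convFrom c Y V z) : EqOn X Y (ball c R) := by
  intro z hz
  refine sub_eq_zero.1 (eq_zero_of_eq_convFrom (X := X - Y) (hX.sub hY) hV hRM ?_ z hz)
  intro w hw
  rw [convFrom_sub hX hY hVc hw, Pi.sub_apply, eX w hw, eY w hw, add_sub_add_left_eq_sub]

/-- The terms of the Neumann series `G + G * V + G * V * V + ⋯` solving the Volterra equation
`Y = G + Y * V`, the convolutions being taken from the base point `c`. -/
def neumannTerm (c : ℂ) (G V : ℂ → A) : ℕ → ℂ → A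
  | 0 => G
  | n + 1 => convFrom c (neumannTerm c G V n) V

theorem norm_neumannTerm_le {ρ B : ℝ} (hρ : ρ < R)
    (hG : ∀ z ∈ closedBall c ρ, ‖G z‖ ≤ B) (hV : ∀ u ∈ ball (0 : ℂ) R, ‖V u‖ ≤ M) (n : ℕ) :
    ∀ z ∈ closedBall c ρ, ‖neumannTerm c G V n z‖ ≤ B * (R * M) ^ n := by
  induction n with
  | zero => simpa [neumannTerm] using hG
  | succ n ih =>
    intro z hz
    have hzR : z ∈ ball c R := closedBall_subset_ball hρ hz
    have hM : 0 ≤ M := (norm_nonneg _).trans (hV 0 (mem_ball_self (pos_of_mem_ball hzR)))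
    calc ‖neumannTerm c G V (n + 1) z‖
        ≤ ‖z - c‖ * (B * (R * M) ^ n * M) := norm_convFrom_le hzR (fun u hu =>
          ih u (closedBall_subset_closedBall (mem_closedBall_iff_norm.1 hz) hu)) hV
      _ = ‖z - c‖ * M * (B * (R * M) ^ n) := by ring
      _ ≤ R * M * (B * (R * M) ^ n) := mul_le_mul_of_nonneg_right
        (mul_norm_sub_le_of_mem_ball hzR hM) ((norm_nonneg _).trans (ih z hz))
      _ = B * (R * M) ^ (n + 1) := by ring

variable [CompleteSpace A]

theorem differentiableOn_neumannTerm (hG : DifferentiableOn ℂ G (ball c R))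
    (hV : DifferentiableOn ℂ V (ball 0 R)) (n : ℕ) :
    DifferentiableOn ℂ (neumannTerm c G V n) (ball c R) := by
  induction n with
  | zero => exact hG
  | succ n ih => exact differentiableOn_convFrom ih hV

theorem exists_volterra (hG : DifferentiableOn ℂ G (ball c R))
    (hVd : DifferentiableOn ℂ V (ball 0 R)) (hV : ∀ u ∈ ball (0 : ℂ) R, ‖V u‖ ≤ M)
    (hRM : R * M < 1) :
    ∃ Y : ℂ → A, DifferentiableOn ℂ Y (ball c R) ∧
      ∀ z ∈ ball c R, Y z = G z + convFrom c Y V z := by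
  have hdiff := differentiableOn_neumannTerm hG hVd
  have exists_bound : ∀ ρ < R, ∃ B, ∀ n, ∀ z ∈ closedBall c ρ,
      ‖neumannTerm c G V n z‖ ≤ B * (R * M) ^ n := fun ρ hρ =>
    ((isCompact_closedBall c ρ).exists_bound_of_continuousOn (hG.continuousOn.mono
      (closedBall_subset_ball hρ))).imp fun _ hB => norm_neumannTerm_le hρ hB hV
  have hsum : ∀ z ∈ ball c R, ∀ B, Summable fun n : ℕ => B * (R * M) ^ n := fun z hz B =>
    have hR := pos_of_mem_ball hz
    have hM : 0 ≤ M := (norm_nonneg _).trans (hV 0 (mem_ball_self hR))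
    (summable_geometric_of_lt_one (mul_nonneg hR.le hM) hRM).mul_left B
  refine ⟨fun z => ∑' n, neumannTerm c G V n z, fun z hz => ?_, fun z hz => ?_⟩
  · obtain ⟨ρ, hzρ, hρR⟩ := exists_between (mem_ball_iff_norm.1 hz)
    obtain ⟨B, hB⟩ := exists_bound ρ hρR
    have := Complex.differentiableOn_tsum_of_summable_norm (hsum z hz B)
      (fun n => (hdiff n).mono (ball_subset_ball hρR.le)) isOpen_ball
      (fun n w hw => hB n w (ball_subset_closedBall hw))
    exact (this.differentiableAt
      (isOpen_ball.mem_nhds (mem_ball_iff_norm.2 hzρ))).differentiableWithinAt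
  · obtain ⟨B, hB⟩ := exists_bound ‖z - c‖ (mem_ball_iff_norm.1 hz)
    have hconv := hasSum_convFrom (fun n => (hdiff n).continuousOn) hVd.continuousOn hz hB
      (hsum z hz B) hV
    have hz_sum : Summable fun n => neumannTerm c G V n z :=
      .of_norm_bounded (hsum z hz B) fun n => hB n z (by simp [dist_eq_norm])
    rw [← hconv.tsum_eq]
    exact hz_sum.tsum_eq_zero_add

end Volterra

section IdentityTheorem

variable {E : Type*} [NormedAddCommGroup E] [NormedSpace ℂ E] [CompleteSpace E]

theorem eqOn_of_eventuallyEq {X Y : ℂ → E} {U : Set ℂ} (hU : IsOpen U) (hc : IsPreconnected U)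
    (hX : DifferentiableOn ℂ X U) (hY : DifferentiableOn ℂ Y U) {z : ℂ} (hz : z ∈ U)
    (h : X =ᶠ[𝓝 z] Y) : EqOn X Y U :=
  (hX.analyticOnNhd hU).eqOn_of_preconnected_of_eventuallyEq (hY.analyticOnNhd hU) hc hz h

theorem eqOn_inter_ball {X Y : ℂ → E} {a b z : ℂ} {R R' : ℝ}
    (hX : DifferentiableOn ℂ X (ball a R)) (hY : DifferentiableOn ℂ Y (ball b R'))
    (ha : z ∈ ball a R) (hb : z ∈ ball b R') (h : X =ᶠ[𝓝 z] Y) :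
    EqOn X Y (ball a R ∩ ball b R') :=
  eqOn_of_eventuallyEq (isOpen_ball.inter isOpen_ball)
    ((convex_ball a R).inter (convex_ball b R')).isPreconnected
    (hX.mono inter_subset_left) (hY.mono inter_subset_right) ⟨ha, hb⟩ h

end IdentityTheorem

section Chains

variable {E : Type*} [NormedAddCommGroup E] [NormedSpace ℂ E] {f : ℂ → E} {z z' : ℕ → ℂ}
  {κ κ' : ℝ} {X X' : ℕ → ℂ → E}

/-- The functions `X j`, holomorphic on the discs `ball (z j) κ`, continue the germ of `f` at `0`
along the chain of points `z`. -/
structure ContAlong (f : ℂ → E) (z : ℕ → ℂ) (κ : ℝ) (X : ℕ → ℂ → E) : Prop where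
  diff : ∀ j, DifferentiableOn ℂ (X j) (ball (z j) κ)
  start : X 0 =ᶠ[𝓝 0] f
  step : ∀ j, X (j + 1) =ᶠ[𝓝 (z (j + 1))] X j

theorem ContAlong.mono (h : ContAlong f z κ X) (hκ : κ' ≤ κ) : ContAlong f z κ' X :=
  ⟨fun j => (h.diff j).mono (ball_subset_ball hκ), h.start, h.step⟩

variable [CompleteSpace E]

theorem ContAlong.eqOn_succ (h : ContAlong f z κ X) (j : ℕ) (hz : dist (z (j + 1)) (z j) < κ) :
    EqOn (X (j + 1)) (X j) (ball (z (j + 1)) κ ∩ ball (z j) κ) :=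
  eqOn_inter_ball (h.diff _) (h.diff _) (mem_ball_self (dist_nonneg.trans_lt hz)) hz (h.step j)

theorem ContAlong.eqOn_of_near (h : ContAlong f z κ X) (h' : ContAlong f z' κ X') (h0 : z 0 = 0)
    (h0' : z' 0 = 0) (hκ : 0 < κ) (hs : ∀ j, dist (z (j + 1)) (z j) < κ / 4)
    (hs' : ∀ j, dist (z' (j + 1)) (z' j) < κ / 4) (hn : ∀ j, dist (z j) (z' j) < κ / 4) (j : ℕ) :
    EqOn (X j) (X' j) (ball (z j) κ ∩ ball (z' j) κ) := by
  induction j with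
  | zero =>
    refine eqOn_inter_ball (h.diff 0) (h'.diff 0) (z := 0) ?_ ?_ (h.start.trans h'.start.symm)
    · rw [h0]; exact mem_ball_self hκ
    · rw [h0']; exact mem_ball_self hκ
  | succ j ih =>
    have near : z j ∈ ball (z j) κ := mem_ball_self hκ
    have near' : z j ∈ ball (z' j) κ := mem_ball.2 (by linarith [hn j])
    have near_succ : z j ∈ ball (z (j + 1)) κ := mem_ball'.2 (by linarith [hs j])
    have near_succ' : z j ∈ ball (z' (j + 1)) κ := mem_ball.2 <| by
      linarith [dist_triangle_right (z j) (z' (j + 1)) (z' j), hn j, hs' j]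
    refine eqOn_inter_ball (h.diff _) (h'.diff _) near_succ near_succ' ?_
    have hsucc := h.eqOn_succ j (by linarith [hs j])
    have hsucc' := h'.eqOn_succ j (by linarith [hs' j])
    filter_upwards [isOpen_ball.mem_nhds near, isOpen_ball.mem_nhds near',
      isOpen_ball.mem_nhds near_succ, isOpen_ball.mem_nhds near_succ'] with u u1 u2 u3 u4
    rw [hsucc ⟨u3, u1⟩, ih ⟨u1, u2⟩, hsucc' ⟨u4, u2⟩]

theorem ContAlong.eqOn_of_stationary (h : ContAlong f z κ X)
    (hf : DifferentiableOn ℂ f (ball 0 κ)) {i : ℕ} (hz : ∀ j ≤ i, z j = 0) :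
    ∀ j ≤ i, EqOn (X j) f (ball 0 κ) := by
  intro j hj u hu
  have hX : X j =ᶠ[𝓝 0] f := by
    induction j with
    | zero => exact h.start
    | succ j ih => exact (hz _ hj ▸ h.step j).trans (ih (by lia))
  exact eqOn_of_eventuallyEq isOpen_ball (convex_ball _ _).isPreconnected (hz j hj ▸ h.diff j) hf
    (mem_ball_self (pos_of_mem_ball hu)) hX hu

end Chains

section Grid

/-- A discrete deformation of contours: at time `j` the contour attached to the chain `z` runs
through `0 = q 0 j, q 1 j, …, q j j = z j`, and stays at `z j` afterwards. -/
structure Grid (z : ℕ → ℂ) (q : ℕ → ℕ → ℂ) (η : ℝ) : Prop where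
  left : ∀ j, q 0 j = 0
  diag : ∀ i j, j ≤ i → q i j = z j
  stay : ∀ i, q i (i + 1) = z i
  dist_time : ∀ i j, dist (q i (j + 1)) (q i j) < η
  dist_time_sub : ∀ i j, dist (z (j + 1) - q i (j + 1)) (z j - q i j) < η
  dist_index : ∀ i j, dist (q (i + 1) j) (q i j) < η

namespace Grid

variable {z : ℕ → ℂ} {q : ℕ → ℕ → ℂ} {η κ : ℝ}

theorem diag_self (g : Grid z q η) (j : ℕ) : q j j = z j := g.diag j j le_rfl

theorem chain_zero (g : Grid z q η) : z 0 = 0 := by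
  rw [← g.left 0, g.diag_self]

theorem time_zero (g : Grid z q η) (i : ℕ) : q i 0 = 0 := by
  rw [g.diag i 0 (Nat.zero_le _), g.chain_zero]

theorem dist_chain (g : Grid z q η) (j : ℕ) : dist (z (j + 1)) (z j) < η := by
  rw [← g.diag_self (j + 1), ← g.diag (j + 1) j (Nat.le_succ _)]
  exact g.dist_time _ _

section

variable {E : Type*} [NormedAddCommGroup E] [NormedSpace ℂ E] [CompleteSpace E] {f χ : ℂ → E}
  {V : ℕ → ℕ → ℂ → E} {Y Y' : ℕ → ℂ → E} {i j : ℕ}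

theorem eqOn_of_le (g : Grid z q η) (hf : DifferentiableOn ℂ f (ball 0 κ))
    (hV : ContAlong f (fun j => z j - q i j) κ Y) (hj : j ≤ i) : EqOn (Y j) f (ball 0 κ) :=
  hV.eqOn_of_stationary hf (i := i) (fun k hk => by simp only [g.diag i k hk, sub_self]) j hj

theorem eqOn_index_succ (g : Grid z q (κ / 16)) (hκ : 0 < κ) (hX : ContAlong χ (q i) κ Y)
    (hX' : ContAlong χ (q (i + 1)) κ Y') (j : ℕ) :
    EqOn (Y j) (Y' j) (ball (q i j) κ ∩ ball (q (i + 1) j) κ) :=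
  hX.eqOn_of_near hX' (g.time_zero _) (g.time_zero _) hκ
    (fun j => by linarith [g.dist_time i j]) (fun j => by linarith [g.dist_time (i + 1) j])
    (fun j => by rw [dist_comm]; linarith [g.dist_index i j]) j

theorem eqOn_sub_index_succ (g : Grid z q (κ / 16)) (hκ : 0 < κ)
    (hV : ∀ i, ContAlong f (fun j => z j - q i j) (2 * κ) (V i)) (i j : ℕ) :
    EqOn (V i j) (V (i + 1) j)
      (ball (z j - q i j) (2 * κ) ∩ ball (z j - q (i + 1) j) (2 * κ)) :=
  (hV i).eqOn_of_near (hV (i + 1)) (by simp [g.time_zero, g.chain_zero])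
    (by simp [g.time_zero, g.chain_zero]) (by linarith)
    (fun j => by linarith [g.dist_time_sub i j]) (fun j => by linarith [g.dist_time_sub (i + 1) j])
    (fun j => by rw [dist_sub_left, dist_comm]; linarith [g.dist_index i j]) j

end

variable {A : Type*} [NormedRing A] {X V : ℕ → ℕ → ℂ → A} {i n : ℕ} {ζ : ℂ}

/-- The integrand of the convolution integral at `ζ` along the arc from `q i j` to `q (i + 1) j`:
`X i j` continues the first factor to `q i j`, and `V i j` the second one to `z j - q i j`. -/
def integrand (X V : ℕ → ℕ → ℂ → A) (i j : ℕ) (ζ u : ℂ) : A :=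
  X i j u * V i j (ζ - u)

variable [NormedAlgebra ℂ A] {f χ : ℂ → A}

/-- The inhomogeneous term of the Volterra equation at time `n`: the part of `f + χ * f` carried by
the contour up to `z n`. -/
def contourSum (q : ℕ → ℕ → ℂ) (X V : ℕ → ℕ → ℂ → A) (n : ℕ) (ζ : ℂ) : A :=
  V 0 n ζ + ∑ i ∈ Finset.range n, segmentIntegral (integrand X V i n ζ) (q i n) (q (i + 1) n)

theorem sub_mem_ball_of_dist_lt {ζ u a b : ℂ} {r s t : ℝ} (hζ : dist ζ a < r) (hu : dist u b < s)
    (h : r + s ≤ t) : ζ - u ∈ ball (a - b) t :=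
  mem_ball.2 (by linarith [dist_sub_sub_le ζ u a b])

theorem differentiableOn_integrand (hκ : 0 < κ)
    (hV : ContAlong f (fun j => z j - q i j) (2 * κ) (V i)) (hX : ContAlong χ (q i) κ (X i))
    (hζ : dist ζ (z n) < κ / 2) :
    DifferentiableOn ℂ (integrand X V i n ζ) (ball (q i n) (κ / 2)) :=
  ((hX.diff n).mono (ball_subset_ball (by linarith))).mul <| (hV.diff n).comp (by fun_prop)
    fun _ hu => sub_mem_ball_of_dist_lt hζ hu (by linarith)

variable [CompleteSpace A]

theorem differentiableOn_contourSum (g : Grid z q (κ / 16)) (hκ : 0 < κ)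
    (hV : ∀ i, ContAlong f (fun j => z j - q i j) (2 * κ) (V i))
    (hX : ∀ i < n, ContAlong χ (q i) κ (X i)) :
    DifferentiableOn ℂ (contourSum q X V n) (ball (z n) κ) := by
  refine DifferentiableOn.add ?_ (DifferentiableOn.fun_sum fun i hi => ?_)
  · have := (hV 0).diff n
    simp only [g.left, sub_zero] at this
    exact this.mono (ball_subset_ball (by linarith))
  · exact differentiableOn_segmentIntegral_mul_sub isOpen_ball (convex_ball (q i n) (κ / 2))
      (mem_ball_self (by linarith)) (mem_ball.2 (by linarith [g.dist_index i n]))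
      (((hX i (Finset.mem_range.1 hi)).diff n).continuousOn.mono (ball_subset_ball (by linarith)))
      ((hV i).diff n) fun w hw u hu => sub_mem_ball_of_dist_lt hw hu (by linarith)

theorem eqOn_integrand_time_succ (g : Grid z q (κ / 16)) (hκ : 0 < κ)
    (hV : ContAlong f (fun j => z j - q i j) (2 * κ) (V i)) (hX : ContAlong χ (q i) κ (X i))
    (hζ : dist ζ (z n) < κ / 2) (hζ' : dist ζ (z (n + 1)) < κ / 2) :
    EqOn (integrand X V i (n + 1) ζ) (integrand X V i n ζ) (ball (q i n) (κ / 2)) := by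
  intro u hu
  have hstep := g.dist_time i n
  have hu' : dist u (q i (n + 1)) < κ := by
    linarith [mem_ball.1 hu, dist_triangle_right u (q i (n + 1)) (q i n)]
  have hXu := hX.eqOn_succ n (by linarith) ⟨hu', ball_subset_ball (by linarith) hu⟩
  have hVu := hV.eqOn_succ n (by linarith [g.dist_time_sub i n])
    ⟨sub_mem_ball_of_dist_lt hζ' hu' (by linarith), sub_mem_ball_of_dist_lt hζ hu (by linarith)⟩
  simp only [integrand, hXu, hVu]

theorem eqOn_integrand_index_succ (g : Grid z q (κ / 16)) (hκ : 0 < κ)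
    (hV : ∀ i, ContAlong f (fun j => z j - q i j) (2 * κ) (V i))
    (hX : ContAlong χ (q i) κ (X i)) (hX' : ContAlong χ (q (i + 1)) κ (X (i + 1)))
    (hζ : dist ζ (z n) < κ / 2) :
    EqOn (integrand X V i n ζ) (integrand X V (i + 1) n ζ) (ball (q i n) (κ / 2)) := by
  intro u hu
  have hu' : dist u (q (i + 1) n) < κ := by
    linarith [mem_ball.1 hu, dist_triangle_right u (q (i + 1) n) (q i n), g.dist_index i n]
  have hXu := g.eqOn_index_succ hκ hX hX' n ⟨ball_subset_ball (by linarith) hu, hu'⟩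
  have hVu := g.eqOn_sub_index_succ hκ hV i n
    ⟨sub_mem_ball_of_dist_lt hζ hu (by linarith), sub_mem_ball_of_dist_lt hζ hu' (by linarith)⟩
  simp only [integrand, hXu, hVu]

-- Cauchy's theorem for the cell with corners `q i n`, `q i (n + 1)`, `q (i + 1) n` and
-- `q (i + 1) (n + 1)`.
theorem segmentIntegral_integrand_time_succ_sub (g : Grid z q (κ / 16)) (hκ : 0 < κ)
    (hV : ∀ i, ContAlong f (fun j => z j - q i j) (2 * κ) (V i))
    (hX : ContAlong χ (q i) κ (X i)) (hX' : ContAlong χ (q (i + 1)) κ (X (i + 1)))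
    (hζ : dist ζ (z n) < κ / 2) (hζ' : dist ζ (z (n + 1)) < κ / 2) :
    segmentIntegral (integrand X V i (n + 1) ζ) (q i (n + 1)) (q (i + 1) (n + 1)) -
      segmentIntegral (integrand X V i n ζ) (q i n) (q (i + 1) n) =
    segmentIntegral (integrand X V (i + 1) n ζ) (q (i + 1) n) (q (i + 1) (n + 1)) -
      segmentIntegral (integrand X V i n ζ) (q i n) (q i (n + 1)) := by
  let D := ball (q i n) (κ / 2)
  have hD : Convex ℝ D := convex_ball _ _
  have time_mem : q i (n + 1) ∈ D := mem_ball.2 (by linarith [g.dist_time i n])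
  have index_mem : q (i + 1) n ∈ D := mem_ball.2 (by linarith [g.dist_index i n])
  have corner_mem : q (i + 1) (n + 1) ∈ D := mem_ball.2 <| by
    linarith [dist_triangle (q (i + 1) (n + 1)) (q (i + 1) n) (q i n), g.dist_time (i + 1) n,
      g.dist_index i n]
  have self_mem : q i n ∈ D := mem_ball_self (by linarith)
  obtain ⟨Q, hQ⟩ := exists_primitive_segmentIntegral (differentiableOn_integrand hκ (hV i) hX hζ)
  rw [segmentIntegral_congr hD time_mem corner_mem
      (g.eqOn_integrand_time_succ hκ (hV i) hX hζ hζ'),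
    ← segmentIntegral_congr hD index_mem corner_mem
      (g.eqOn_integrand_index_succ hκ hV hX hX' hζ),
    hQ _ time_mem _ corner_mem, hQ _ self_mem _ index_mem, hQ _ index_mem _ corner_mem,
    hQ _ self_mem _ time_mem]
  abel

theorem sum_segmentIntegral_integrand_time_succ (g : Grid z q (κ / 16)) (hκ : 0 < κ)
    (hV : ∀ i, ContAlong f (fun j => z j - q i j) (2 * κ) (V i))
    (hX : ∀ i ≤ n, ContAlong χ (q i) κ (X i))
    (hζ : dist ζ (z n) < κ / 2) (hζ' : dist ζ (z (n + 1)) < κ / 2) :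
    ∑ i ∈ Finset.range n,
      segmentIntegral (integrand X V i (n + 1) ζ) (q i (n + 1)) (q (i + 1) (n + 1)) =
    ∑ i ∈ Finset.range n, segmentIntegral (integrand X V i n ζ) (q i n) (q (i + 1) n) := by
  rw [← sub_eq_zero, ← Finset.sum_sub_distrib, Finset.sum_congr rfl fun i hi =>
      g.segmentIntegral_integrand_time_succ_sub hκ hV (hX i (Finset.mem_range.1 hi).le)
        (hX (i + 1) (Finset.mem_range.1 hi)) hζ hζ',
    Finset.sum_range_sub fun i => segmentIntegral (integrand X V i n ζ) (q i n) (q i (n + 1))]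
  simp only [g.left, g.diag_self, g.stay, segmentIntegral_self, sub_zero]

theorem segmentIntegral_integrand_add_convFrom (g : Grid z q (κ / 16)) (hκ : 0 < κ)
    (hf : DifferentiableOn ℂ f (ball 0 (2 * κ)))
    (hV : ContAlong f (fun j => z j - q n j) (2 * κ) (V n)) (hX : ContAlong χ (q n) κ (X n))
    (hζ : dist ζ (z n) < κ / 2) (hζ' : dist ζ (z (n + 1)) < κ / 2) :
    segmentIntegral (integrand X V n (n + 1) ζ) (q n (n + 1)) (q (n + 1) (n + 1)) +
      convFrom (z (n + 1)) (X n n) f ζ = convFrom (z n) (X n n) f ζ := by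
  let D := ball (z n) (κ / 2)
  have hD : Convex ℝ D := convex_ball _ _
  have self_mem : z n ∈ D := mem_ball_self (by linarith)
  have succ_mem : z (n + 1) ∈ D := mem_ball.2 (by linarith [g.dist_chain n])
  have hlast : EqOn (integrand X V n n ζ) (fun u => X n n u * f (ζ - u)) D := by
    intro u hu
    have hmem : ζ - u ∈ ball 0 (2 * κ) := by
      simpa only [sub_self] using sub_mem_ball_of_dist_lt hζ hu (by linarith : _ ≤ 2 * κ)
    simp only [integrand, g.eqOn_of_le hf hV le_rfl hmem]
  have hdiff := differentiableOn_integrand (n := n) hκ hV hX hζ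
  have htime := g.eqOn_integrand_time_succ hκ hV hX hζ hζ'
  rw [g.diag_self] at hdiff htime
  obtain ⟨Q, hQ⟩ := exists_primitive_segmentIntegral (hdiff.congr hlast.symm)
  rw [g.stay, g.diag_self, segmentIntegral_congr hD self_mem succ_mem (htime.trans hlast),
    convFrom, convFrom, hQ _ self_mem _ succ_mem, hQ _ succ_mem _ hζ, hQ _ self_mem _ hζ]
  abel

theorem contourSum_add_convFrom_time_succ (g : Grid z q (κ / 16)) (hκ : 0 < κ)
    (hf : DifferentiableOn ℂ f (ball 0 (2 * κ)))
    (hV : ∀ i, ContAlong f (fun j => z j - q i j) (2 * κ) (V i))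
    (hX : ∀ i ≤ n, ContAlong χ (q i) κ (X i))
    (hζ : dist ζ (z n) < κ / 2) (hζ' : dist ζ (z (n + 1)) < κ / 2) :
    contourSum q X V (n + 1) ζ + convFrom (z (n + 1)) (X n n) f ζ =
      contourSum q X V n ζ + convFrom (z n) (X n n) f ζ := by
  have hV0 : V 0 (n + 1) ζ = V 0 n ζ := by
    refine (hV 0).eqOn_succ n (by linarith [g.dist_time_sub 0 n]) ⟨?_, ?_⟩ <;>
    · rw [g.left, sub_zero, mem_ball]
      linarith
  rw [← g.segmentIntegral_integrand_add_convFrom hκ hf (hV n) (hX n le_rfl) hζ hζ', contourSum,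
    Finset.sum_range_succ, g.sum_segmentIntegral_integrand_time_succ hκ hV hX hζ hζ', hV0,
    contourSum]
  abel

theorem eventually_eq_contourSum_succ (g : Grid z q (κ / 16)) (hκ : 0 < κ)
    (hf : DifferentiableOn ℂ f (ball 0 (2 * κ)))
    (hV : ∀ i, ContAlong f (fun j => z j - q i j) (2 * κ) (V i))
    (hX : ∀ i ≤ n, ContAlong χ (q i) κ (X i))
    (h : ∀ᶠ ζ in 𝓝 (z n), X n n ζ = contourSum q X V n ζ + convFrom (z n) (X n n) f ζ) :
    ∀ᶠ ζ in 𝓝 (z (n + 1)), X n n ζ =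
      contourSum q X V (n + 1) ζ + convFrom (z (n + 1)) (X n n) f ζ := by
  have hXn := (hX n le_rfl).diff n
  rw [g.diag_self] at hXn
  have hdisc : EqOn (X n n) (fun ζ => contourSum q X V n ζ + convFrom (z n) (X n n) f ζ)
      (ball (z n) κ) :=
    eqOn_of_eventuallyEq isOpen_ball (convex_ball _ _).isPreconnected hXn
      ((g.differentiableOn_contourSum hκ hV fun i hi => hX i hi.le).add
        (differentiableOn_convFrom hXn (hf.mono (ball_subset_ball (by linarith)))))
      (mem_ball_self hκ) h
  filter_upwards [ball_mem_nhds (z (n + 1)) (by linarith : 0 < κ / 4)] with ζ hζ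
  rw [mem_ball] at hζ
  have hζn : dist ζ (z n) < κ / 2 := by
    linarith [dist_triangle ζ (z (n + 1)) (z n), g.dist_chain n]
  rw [g.contourSum_add_convFrom_time_succ hκ hf hV hX hζn (by linarith)]
  exact hdisc (ball_subset_ball (by linarith) hζn)

theorem eventually_eq_contourSum (g : Grid z q (κ / 16)) (hκ : 0 < κ)
    (hf : DifferentiableOn ℂ f (ball 0 (2 * κ)))
    (hχ : ∀ᶠ ζ in 𝓝 0, χ ζ = f ζ + convFrom 0 χ f ζ)
    (hV : ∀ i, ContAlong f (fun j => z j - q i j) (2 * κ) (V i))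
    (hX : ∀ i ≤ n, ContAlong χ (q i) κ (X i)) :
    ∀ᶠ ζ in 𝓝 (z n), X n n ζ = contourSum q X V n ζ + convFrom (z n) (X n n) f ζ := by
  induction n with
  | zero =>
    rw [g.chain_zero]
    filter_upwards [hχ, (hX 0 le_rfl).start, (hV 0).start,
      convFrom_congr_eventually (V := f) (hX 0 le_rfl).start] with ζ h1 h2 h3 h4
    rw [h2, h4, h1, contourSum, h3, Finset.range_zero, Finset.sum_empty, add_zero]
  | succ n ih =>
    have hXn := hX n (Nat.le_succ n)
    have hXsucc := hX (n + 1) le_rfl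
    have heq := g.eventually_eq_contourSum_succ hκ hf hV (fun i hi => hX i (by lia))
      (ih fun i hi => hX i (by lia))
    have hindex : X n n =ᶠ[𝓝 (z (n + 1))] X (n + 1) n := by
      have := g.eqOn_index_succ hκ hXn hXsucc n
      rw [g.diag_self, g.diag (n + 1) n (Nat.le_succ _), inter_self] at this
      exact this.eventuallyEq_of_mem (isOpen_ball.mem_nhds
        (mem_ball.2 (by linarith [g.dist_chain n])))
    have hstep := hXsucc.step n
    rw [g.diag_self] at hstep
    have hcont : X (n + 1) (n + 1) =ᶠ[𝓝 (z (n + 1))] X n n := hstep.trans hindex.symm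
    filter_upwards [heq, hcont, convFrom_congr_eventually (V := f) hcont] with ζ h1 h2 h3
    rw [h2, h3, h1]

theorem exists_extension (g : Grid z q (κ / 16)) (hκ : 0 < κ)
    (hf : DifferentiableOn ℂ f (ball 0 (2 * κ))) {M : ℝ} (hM : ∀ u ∈ ball (0 : ℂ) κ, ‖f u‖ ≤ M)
    (hκM : κ * M < 1) (hχ : ∀ᶠ ζ in 𝓝 0, χ ζ = f ζ + convFrom 0 χ f ζ)
    (hV : ∀ i, ContAlong f (fun j => z j - q i j) (2 * κ) (V i))
    (hX : ∀ i ≤ n, ContAlong χ (q i) κ (X i)) :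
    ∃ Y : ℂ → A, DifferentiableOn ℂ Y (ball (z (n + 1)) κ) ∧ Y =ᶠ[𝓝 (z (n + 1))] X n n := by
  have hfκ := hf.mono (ball_subset_ball (by linarith : κ ≤ 2 * κ))
  obtain ⟨Y, hY, eY⟩ := exists_volterra
    (g.differentiableOn_contourSum (n := n + 1) hκ hV fun i hi => hX i (by lia)) hfκ hM hκM
  refine ⟨Y, hY, ?_⟩
  have hXn := (hX n le_rfl).diff n
  rw [g.diag_self] at hXn
  have hzn : z (n + 1) ∈ ball (z n) κ := mem_ball.2 (by linarith [g.dist_chain n])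
  obtain ⟨r, hr, hr_ball⟩ := Metric.eventually_nhds_iff_ball.1
    ((g.eventually_eq_contourSum_succ hκ hf hV hX (g.eventually_eq_contourSum hκ hf hχ hV hX)).and
      (isOpen_ball.mem_nhds hzn))
  have hM0 : 0 ≤ M := (norm_nonneg _).trans (hM 0 (mem_ball_self hκ))
  have hr_sub : ball (z (n + 1)) (min r κ) ⊆ ball (z (n + 1)) r :=
    ball_subset_ball (min_le_left _ _)
  have hκ_sub : ∀ c : ℂ, ball c (min r κ) ⊆ ball c κ := fun c => ball_subset_ball (min_le_right _ _)
  exact (eqOn_of_volterra (hY.continuousOn.mono (hκ_sub _))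
    (hXn.continuousOn.mono fun u hu => (hr_ball u (hr_sub hu)).2)
    (hfκ.continuousOn.mono (hκ_sub _)) (fun u hu => hM u (hκ_sub _ hu))
    ((mul_le_mul_of_nonneg_right (min_le_right _ _) hM0).trans_lt hκM)
    (fun u hu => eY u (hκ_sub _ hu)) (fun u hu => (hr_ball u (hr_sub hu)).1)).eventuallyEq_of_mem
    (ball_mem_nhds _ (lt_min hr hκ))

end Grid

end Grid

section MarginChain

/-- The point `p` of `ℝ × ℂ` is at distance at least `ε` from `S`. -/
def Margin (S : Set (ℝ × ℂ)) (ε : ℝ) (p : ℝ × ℂ) : Prop := ∀ s ∈ S, ε ≤ dist p s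

theorem Margin.mono {S S' : Set (ℝ × ℂ)} {ε ε' : ℝ} {p : ℝ × ℂ} (h : Margin S ε p) (hS : S' ⊆ S)
    (hε : ε' ≤ ε) : Margin S' ε' p := fun s hs => hε.trans (h s (hS hs))

theorem Margin.of_dist_le {S : Set (ℝ × ℂ)} {a b c : ℝ} {p p' : ℝ × ℂ} (h : Margin S a p)
    (hd : dist p' p ≤ b) (hc : c + b ≤ a) : Margin S c p' := fun s hs => by
  linarith [h s hs, dist_triangle_left p s p']

/-- A chain of points of `ℂ` starting at `0`, each point being paired with an upper bound of the
length travelled so far. -/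
structure IsChain (p : ℕ → ℝ × ℂ) : Prop where
  zero : p 0 = 0
  step : ∀ j, dist (p (j + 1)).2 (p j).2 ≤ (p (j + 1)).1 - (p j).1

variable {p w : ℕ → ℝ × ℂ}

theorem IsChain.dist_step (h : IsChain p) (j : ℕ) :
    dist (p (j + 1)) (p j) = (p (j + 1)).1 - (p j).1 := by
  rw [Prod.dist_eq, Real.dist_eq, abs_of_nonneg (dist_nonneg.trans (h.step j)),
    max_eq_left (h.step j)]

theorem IsChain.monotone (h : IsChain p) : Monotone fun j => (p j).1 :=
  monotone_nat_of_le_succ fun j => sub_nonneg.1 (dist_nonneg.trans (h.step j))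

theorem IsChain.nonneg (h : IsChain p) (j : ℕ) : 0 ≤ (p j).1 := by
  simpa [h.zero] using h.monotone (Nat.zero_le j)

theorem IsChain.of_smul (h : IsChain p) (h0 : w 0 = 0)
    (hw : ∀ j, ∃ c : ℝ, 0 ≤ c ∧ w (j + 1) - w j = c • (p (j + 1) - p j)) : IsChain w := by
  refine ⟨h0, fun j => ?_⟩
  obtain ⟨c, hc, e⟩ := hw j
  rw [dist_eq_norm, ← Prod.snd_sub, ← Prod.fst_sub, e, Prod.smul_fst, Prod.smul_snd, norm_smul,
    Real.norm_of_nonneg hc, smul_eq_mul, Prod.snd_sub, ← dist_eq_norm]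
  exact mul_le_mul_of_nonneg_left (h.step j) hc

/-- `f` can be continued on discs of radius `κ` along all chains of mesh `κ` and length at most `Λ`
that keep the distance `ε` from `S`. -/
def ChainContMesh {E : Type*} [NormedAddCommGroup E] [NormedSpace ℂ E] (S : Set (ℝ × ℂ))
    (f : ℂ → E) (Λ ε κ : ℝ) : Prop :=
  ∀ p : ℕ → ℝ × ℂ, IsChain p → (∀ j, (p (j + 1)).1 - (p j).1 < κ) → (∀ j, Margin S ε (p j)) →
    (∀ j, (p j).1 ≤ Λ) → ∃ X, ContAlong f (fun j => (p j).2) κ X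

/-- `f` can be continued, on discs of fixed radius, along all sufficiently fine chains of length
at most `Λ` that keep a given distance from `S`. -/
def ChainCont {E : Type*} [NormedAddCommGroup E] [NormedSpace ℂ E] (S : Set (ℝ × ℂ)) (f : ℂ → E)
    (Λ : ℝ) : Prop :=
  ∀ ε > 0, ∃ κ > 0, ChainContMesh S f Λ ε κ

end MarginChain

section Flow

/-- The function `θ` takes its values in `[0, 1]`, is Lipschitz, equals `1` on the
`e`-neighbourhood of `S` and vanishes off the `2 e`-neighbourhood of `S`. -/
structure IsCutoff (S : Set (ℝ × ℂ)) (e : ℝ) (θ : ℝ × ℂ → ℝ) : Prop where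
  mem_Icc : ∀ x, θ x ∈ Icc (0 : ℝ) 1
  dist_le : ∀ x y, dist (θ x) (θ y) ≤ e⁻¹ * dist x y
  exists_dist_lt : ∀ x, θ x ≠ 0 → ∃ s ∈ S, dist x s < 2 * e
  margin : ∀ x, θ x ≠ 1 → Margin S e x

theorem exists_isCutoff (S : Set (ℝ × ℂ)) {e : ℝ} (he : 0 < e) : ∃ θ, IsCutoff S e θ := by
  refine ⟨fun x => (thickenedIndicator he (thickening e S) x : ℝ), fun x => ⟨NNReal.coe_nonneg _,
    NNReal.coe_le_one.2 (thickenedIndicator_le_one he _ x)⟩, fun x y => ?_, fun x hx => ?_,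
    fun x hx s hs => ?_⟩
  · have := (lipschitzWith_thickenedIndicator he (thickening e S)).dist_le_mul x y
    rwa [NNReal.coe_inv, Real.coe_toNNReal e he.le] at this
  · contrapose! hx
    refine NNReal.coe_eq_zero.2 (thickenedIndicator_zero he _ fun hmem => ?_)
    obtain ⟨y, hy, hxy⟩ := mem_thickening_iff.1 hmem
    obtain ⟨s, hs, hys⟩ := mem_thickening_iff.1 hy
    linarith [hx s hs, dist_triangle x y s]
  · contrapose! hx
    exact NNReal.coe_eq_one.2 (thickenedIndicator_one he _ (mem_thickening_iff.2 ⟨s, hs, hx⟩))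

variable {S T : Set (ℝ × ℂ)} {e κ d Λ : ℝ} {θ : ℝ × ℂ → ℝ} {p : ℕ → ℝ × ℂ} {i j : ℕ}

theorem IsCutoff.eq_zero_of_margin (hθ : IsCutoff S e θ) {x : ℝ × ℂ} (hx : Margin S (2 * e) x) :
    θ x = 0 := by
  by_contra hne
  obtain ⟨s, hs, hd⟩ := hθ.exists_dist_lt x hne
  linarith [hx s hs]

theorem IsCutoff.eq_zero_of_fst_le (hθ : IsCutoff S e θ) {δ : ℝ} (hS : ∀ s ∈ S, δ ≤ s.1)
    {x : ℝ × ℂ} (hx : x.1 + 2 * e ≤ δ) : θ x = 0 :=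
  hθ.eq_zero_of_margin fun s hs => calc
    2 * e ≤ s.1 - x.1 := by linarith [hS s hs]
    _ ≤ dist x.1 s.1 := by
      rw [dist_comm]
      exact le_abs_self _
    _ ≤ dist x s := le_max_left _ _

/-- The discrete flow driven by the chain `p`, slowed down by the cutoff `θ`; the `i`-th
trajectory stays at `0` until time `i`. -/
def flow (θ : ℝ × ℂ → ℝ) (p : ℕ → ℝ × ℂ) (i : ℕ) : ℕ → ℝ × ℂ
  | 0 => 0
  | j + 1 => if j < i then 0 else flow θ p i j + (1 - θ (flow θ p i j)) • (p (j + 1) - p j)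

theorem flow_of_le (h : j ≤ i) : flow θ p i j = 0 := by
  cases j with
  | zero => rfl
  | succ j => rw [flow, if_pos (by lia)]

theorem flow_succ (h : i ≤ j) :
    flow θ p i (j + 1) = flow θ p i j + (1 - θ (flow θ p i j)) • (p (j + 1) - p j) := by
  rw [flow, if_neg (by lia)]

theorem flow_zero_index (hp : IsChain p) (hθ : ∀ j, θ (p j) = 0) (j : ℕ) :
    flow θ p 0 j = p j := by
  induction j with
  | zero => rw [hp.zero]; rfl
  | succ j ih => rw [flow_succ (Nat.zero_le _), ih, hθ, sub_zero, one_smul, add_sub_cancel]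

theorem exists_flow_sub_eq_smul (hθ : ∀ x, θ x ∈ Icc (0 : ℝ) 1) (i j : ℕ) :
    ∃ c ∈ Icc (0 : ℝ) 1, flow θ p i (j + 1) - flow θ p i j = c • (p (j + 1) - p j) ∧
      (c ≠ 0 → θ (flow θ p i j) ≠ 1) := by
  rcases lt_or_ge j i with h | h
  · exact ⟨0, unitInterval.zero_mem, by simp [flow_of_le h, flow_of_le h.le], by simp⟩
  · exact ⟨1 - θ (flow θ p i j), Icc.one_sub_mem (hθ _),
      by rw [flow_succ h, add_sub_cancel_left], fun hc h' => hc (by rw [h', sub_self])⟩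

theorem isChain_flow (hp : IsChain p) (hθ : ∀ x, θ x ∈ Icc (0 : ℝ) 1) (i : ℕ) :
    IsChain (flow θ p i) := by
  refine hp.of_smul rfl fun j => ?_
  obtain ⟨c, hc, h, -⟩ := exists_flow_sub_eq_smul (p := p) hθ i j
  exact ⟨c, hc.1, h⟩

theorem isChain_sub_flow (hp : IsChain p) (hθ : ∀ x, θ x ∈ Icc (0 : ℝ) 1) (i : ℕ) :
    IsChain fun j => p j - flow θ p i j := by
  refine hp.of_smul (by simp [hp.zero, flow]) fun j => ?_
  obtain ⟨c, hc, h, -⟩ := exists_flow_sub_eq_smul (p := p) hθ i j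
  exact ⟨1 - c, sub_nonneg.2 hc.2, by rw [sub_sub_sub_comm, h, sub_smul, one_smul]⟩

theorem flow_fst_le (hp : IsChain p) (hθ : ∀ x, θ x ∈ Icc (0 : ℝ) 1) (i j : ℕ) :
    (flow θ p i j).1 ≤ (p j).1 :=
  sub_nonneg.1 ((isChain_sub_flow hp hθ i).nonneg j)

theorem dist_flow_succ_le (hp : IsChain p) (hθ : ∀ x, θ x ∈ Icc (0 : ℝ) 1) (i j : ℕ) :
    dist (flow θ p i (j + 1)) (flow θ p i j) ≤ (p (j + 1)).1 - (p j).1 := by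
  have := (isChain_sub_flow hp hθ i).monotone (Nat.le_succ j)
  rw [(isChain_flow hp hθ i).dist_step]
  simp only [Prod.fst_sub] at this
  linarith

theorem dist_sub_flow_succ_le (hp : IsChain p) (hθ : ∀ x, θ x ∈ Icc (0 : ℝ) 1) (i j : ℕ) :
    dist (p (j + 1) - flow θ p i (j + 1)) (p j - flow θ p i j) ≤ (p (j + 1)).1 - (p j).1 := by
  rw [(isChain_sub_flow hp hθ i).dist_step]
  simp only [Prod.fst_sub]
  linarith [(isChain_flow hp hθ i).monotone (Nat.le_succ j)]

theorem sub_flow_succ_of_eq_zero (h : i ≤ j) (hθ : θ (flow θ p i j) = 0) :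
    p (j + 1) - flow θ p i (j + 1) = p j - flow θ p i j := by
  rw [flow_succ h, hθ, sub_zero, one_smul]
  abel

theorem margin_flow (hp : IsChain p) (hθ : IsCutoff S e θ) (hS : Margin S e 0) (he : 0 < e)
    (hs : ∀ j, (p (j + 1)).1 - (p j).1 ≤ e / 2) (i j : ℕ) : Margin S (e / 2) (flow θ p i j) := by
  induction j with
  | zero => exact hS.mono subset_rfl (by linarith)
  | succ j ih =>
    obtain ⟨c, -, h, hc⟩ := exists_flow_sub_eq_smul (p := p) hθ.mem_Icc i j
    by_cases hc0 : c = 0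
    · rw [hc0, zero_smul, sub_eq_zero] at h
      rwa [h]
    · exact (hθ.margin _ (hc hc0)).of_dist_le
        ((dist_flow_succ_le hp hθ.mem_Icc i j).trans (hs j)) (by linarith)

-- Where `p - flow` moves, `flow` is within `2 e` of a point `s` of `S`; as `s + t ∈ T`, the point
-- `p - flow` then cannot be within `2 e` of `t ∈ T`.
theorem margin_sub_flow (hp : IsChain p) (hθ : IsCutoff S e θ)
    (hadd : ∀ s ∈ S, ∀ t ∈ T, s + t ∈ T) (he : 0 < e)
    (hs : ∀ j, (p (j + 1)).1 - (p j).1 ≤ e) (hT : ∀ j, Margin T (4 * e) (p j))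
    (i j : ℕ) : Margin T e (p j - flow θ p i j) := by
  induction j with
  | zero =>
    rw [flow_of_le (Nat.zero_le _), sub_zero]
    exact (hT 0).mono subset_rfl (by linarith)
  | succ j ih =>
    rcases lt_or_ge j i with h | h
    · rw [flow_of_le h, sub_zero]
      exact (hT _).mono subset_rfl (by linarith)
    by_cases hzero : θ (flow θ p i j) = 0
    · rwa [sub_flow_succ_of_eq_zero h hzero]
    · obtain ⟨s, hsS, hd⟩ := hθ.exists_dist_lt _ hzero
      have hm : Margin T (2 * e) (p j - flow θ p i j) := fun t ht => by
        have := dist_add_add_le (flow θ p i j) (p j - flow θ p i j) s t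
        rw [add_sub_cancel] at this
        linarith [hT j _ (hadd s hsS t ht)]
      exact hm.of_dist_le ((dist_sub_flow_succ_le hp hθ.mem_Icc i j).trans (hs j)) (by linarith)

theorem dist_add_smul_le (hθ : IsCutoff S e θ) (a b v : ℝ × ℂ) :
    dist (a + (1 - θ a) • v) (b + (1 - θ b) • v) ≤ dist a b * (e⁻¹ * ‖v‖ + 1) := by
  calc dist (a + (1 - θ a) • v) (b + (1 - θ b) • v)
      = ‖(a - b) - (θ a - θ b) • v‖ := by rw [dist_eq_norm]; congr 1; module
    _ ≤ ‖a - b‖ + ‖(θ a - θ b) • v‖ := norm_sub_le _ _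
    _ ≤ dist a b + e⁻¹ * dist a b * ‖v‖ := by
      rw [norm_smul, ← dist_eq_norm, ← dist_eq_norm]
      gcongr
      exact hθ.dist_le a b
    _ = dist a b * (e⁻¹ * ‖v‖ + 1) := by ring

theorem dist_flow_index_succ_le (hp : IsChain p) (hθ : IsCutoff S e θ) (he : 0 < e)
    (hθ0 : θ 0 = 0) (hκ : 0 ≤ κ) (hs : ∀ j, (p (j + 1)).1 - (p j).1 ≤ κ) (i j : ℕ) :
    dist (flow θ p (i + 1) j) (flow θ p i j) ≤ κ * Real.exp (e⁻¹ * (p j).1) := by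
  induction j with
  | zero => simp only [flow, dist_self]; positivity
  | succ j ih =>
    rcases lt_trichotomy j i with h | rfl | h
    · rw [flow_of_le (by lia), flow_of_le (by lia), dist_self]; positivity
    · rw [flow_of_le le_rfl, flow_succ le_rfl, flow_of_le le_rfl, hθ0, zero_add, sub_zero,
        one_smul, dist_zero_left, ← dist_eq_norm, hp.dist_step]
      refine (hs j).trans (le_mul_of_one_le_right hκ (Real.one_le_exp ?_))
      exact mul_nonneg (inv_nonneg.2 he.le) (hp.nonneg _)
    · rw [flow_succ (by lia : i + 1 ≤ j), flow_succ h.le]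
      calc _ ≤ dist (flow θ p (i + 1) j) (flow θ p i j) * (e⁻¹ * ‖p (j + 1) - p j‖ + 1) :=
            dist_add_smul_le hθ _ _ _
        _ ≤ κ * Real.exp (e⁻¹ * (p j).1) * Real.exp (e⁻¹ * ‖p (j + 1) - p j‖) := by
          gcongr
          exact Real.add_one_le_exp _
        _ = κ * Real.exp (e⁻¹ * (p (j + 1)).1) := by
          rw [← dist_eq_norm, hp.dist_step, mul_assoc, ← Real.exp_add]
          ring_nf

theorem sub_flow_fst_le (hp : IsChain p) (hθ : ∀ x, θ x ∈ Icc (0 : ℝ) 1)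
    (hd : ∀ x : ℝ × ℂ, x.1 ≤ d → θ x = 0) (hΛ : ∀ j, (p j).1 ≤ Λ + d) (hi : (p i).1 ≤ Λ) (j : ℕ) :
    (p j - flow θ p i j).1 ≤ Λ := by
  induction j with
  | zero =>
    rw [flow_of_le (Nat.zero_le _), sub_zero]
    exact (hp.monotone (Nat.zero_le i)).trans hi
  | succ j ih =>
    rcases lt_or_ge j i with h | h
    · rw [flow_of_le h, sub_zero]
      exact (hp.monotone (Nat.succ_le_of_lt h)).trans hi
    by_cases hzero : θ (flow θ p i j) = 0
    · rwa [sub_flow_succ_of_eq_zero h hzero]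
    · have hlt : d < (flow θ p i j).1 := not_le.1 fun hle => hzero (hd _ hle)
      have hmono : (flow θ p i j).1 ≤ (flow θ p i (j + 1)).1 :=
        (isChain_flow hp hθ i).monotone (Nat.le_succ j)
      rw [Prod.fst_sub]
      linarith [hΛ (j + 1)]

theorem sub_flow_eq_of_le (hd : ∀ x : ℝ × ℂ, x.1 ≤ d → θ x = 0)
    (hi : ∀ j, (p j).1 - (p i).1 ≤ d) (hj : i ≤ j) : p j - flow θ p i j = p i := by
  induction j, hj using Nat.le_induction with
  | base => rw [flow_of_le le_rfl, sub_zero]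
  | succ j hj ih =>
    have hflow : flow θ p i j = p j - p i := by rw [← ih, sub_sub_cancel]
    rw [sub_flow_succ_of_eq_zero hj (hd _ (by rw [hflow]; exact hi j)), ih]

end Flow

section Mesh

variable {E : Type*} [NormedAddCommGroup E] [NormedSpace ℂ E] {S S' T : Set (ℝ × ℂ)} {f : ℂ → E}
  {e ε ε' κ κ' d Λ Λ' : ℝ} {θ : ℝ × ℂ → ℝ} {p : ℕ → ℝ × ℂ}

theorem ChainContMesh.mono (h : ChainContMesh S f Λ ε κ) (hS : S ⊆ S') (hΛ : Λ' ≤ Λ)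
    (hε : ε ≤ ε') (hκ : κ' ≤ κ) : ChainContMesh S' f Λ' ε' κ' := fun p hp hs hm hl =>
  (h p hp (fun j => (hs j).trans_le hκ) (fun j => (hm j).mono hS hε)
    fun j => (hl j).trans hΛ).imp fun _ hX => hX.mono hκ

theorem ChainCont.mono (h : ChainCont S f Λ) (hS : S ⊆ S') (hΛ : Λ' ≤ Λ) : ChainCont S' f Λ' :=
  fun ε hε => (h ε hε).imp fun _ hκ => ⟨hκ.1, hκ.2.mono hS hΛ le_rfl le_rfl⟩

theorem ChainContMesh.exists_contAlong_flow (h : ChainContMesh S f Λ (e / 2) κ) (hp : IsChain p)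
    (hθ : IsCutoff S e θ) (hS : Margin S e 0) (he : 0 < e)
    (hsκ : ∀ j, (p (j + 1)).1 - (p j).1 < κ) (hse : ∀ j, (p (j + 1)).1 - (p j).1 ≤ e / 2)
    (hΛ : ∀ j, (p j).1 ≤ Λ) (i : ℕ) :
    ∃ V, ContAlong f (fun j => (p j).2 - (p j - flow θ p i j).2) κ V := by
  have hflow := isChain_flow hp hθ.mem_Icc i
  simp only [Prod.snd_sub, sub_sub_cancel]
  refine h _ hflow (fun j => ?_) (margin_flow hp hθ hS he hse i)
    fun j => (flow_fst_le hp hθ.mem_Icc i j).trans (hΛ j)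
  rw [← hflow.dist_step]
  exact (dist_flow_succ_le hp hθ.mem_Icc i j).trans_lt (hsκ j)

theorem ChainContMesh.exists_contAlong_sub_flow (h : ChainContMesh T f Λ e κ) (hp : IsChain p)
    (hθ : IsCutoff S e θ) (hadd : ∀ s ∈ S, ∀ t ∈ T, s + t ∈ T) (he : 0 < e)
    (hd : ∀ x : ℝ × ℂ, x.1 ≤ d → θ x = 0) (hsκ : ∀ j, (p (j + 1)).1 - (p j).1 < κ)
    (hse : ∀ j, (p (j + 1)).1 - (p j).1 ≤ e) (hT : ∀ j, Margin T (4 * e) (p j))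
    (hΛ : ∀ j, (p j).1 ≤ Λ + d) {i : ℕ} (hi : (p i).1 ≤ Λ) :
    ∃ Y, ContAlong f (fun j => (p j - flow θ p i j).2) κ Y := by
  have hsub := isChain_sub_flow hp hθ.mem_Icc i
  refine h _ hsub (fun j => ?_) (margin_sub_flow hp hθ hadd he hse hT i)
    (sub_flow_fst_le hp hθ.mem_Icc hd hΛ hi)
  rw [← hsub.dist_step]
  exact (dist_sub_flow_succ_le hp hθ.mem_Icc i j).trans_lt (hsκ j)

end Mesh

section Resolvent

theorem ContAlong.splice {E : Type*} [NormedAddCommGroup E] [NormedSpace ℂ E] {f Y : ℂ → E}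
    {z z' : ℕ → ℂ} {κ : ℝ} {X : ℕ → ℂ → E} (h : ContAlong f z κ X) {n : ℕ}
    (hz : ∀ j ≤ n, z' j = z j) (hz' : ∀ j, n < j → z' j = z' (n + 1))
    (hY : DifferentiableOn ℂ Y (ball (z' (n + 1)) κ)) (hXY : Y =ᶠ[𝓝 (z' (n + 1))] X n) :
    ContAlong f z' κ fun j => if j ≤ n then X j else Y := by
  refine ⟨fun j => ?_, by simpa using h.start, fun j => ?_⟩
  · rcases le_or_gt j n with hj | hj
    · rw [if_pos hj, hz j hj]
      exact h.diff j
    · rwa [if_neg hj.not_ge, hz' j hj]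
  · rcases lt_trichotomy j n with hj | rfl | hj
    · rw [if_pos hj.le, if_pos (Nat.succ_le_of_lt hj), hz (j + 1) hj]
      exact h.step j
    · rwa [if_pos le_rfl, if_neg (by lia)]
    · rw [if_neg (by lia), if_neg (by lia)]

variable {A : Type*} [NormedRing A] [NormedAlgebra ℂ A] [CompleteSpace A] {f χ : ℂ → A}
  {z : ℕ → ℂ} {q : ℕ → ℕ → ℂ} {κ M : ℝ}

theorem Grid.exists_family {V : ℕ → ℕ → ℂ → A} (g : Grid z q (κ / 16)) (hκ : 0 < κ)
    (hf : DifferentiableOn ℂ f (ball 0 (2 * κ))) (hM : ∀ u ∈ ball (0 : ℂ) κ, ‖f u‖ ≤ M)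
    (hκM : κ * M < 1) (hχd : DifferentiableOn ℂ χ (ball 0 κ))
    (hχ : ∀ᶠ ζ in 𝓝 0, χ ζ = f ζ + convFrom 0 χ f ζ)
    (hV : ∀ i, ContAlong f (fun j => z j - q i j) (2 * κ) (V i))
    (hq : ∀ i, (∃ Y, ContAlong χ (q i) κ Y) ∨ ∀ j, i ≤ j → q i j = z i) (n : ℕ) :
    ∃ X : ℕ → ℕ → ℂ → A, ∀ i ≤ n, ContAlong χ (q i) κ (X i) := by
  induction n with
  | zero =>
    refine ⟨fun _ _ => χ, fun i hi => ?_⟩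
    rw [Nat.le_zero.1 hi]
    exact ⟨fun j => by rwa [g.left], EventuallyEq.rfl, fun j => EventuallyEq.rfl⟩
  | succ n ih =>
    obtain ⟨X, hX⟩ := ih
    obtain ⟨Y, hY⟩ : ∃ Y, ContAlong χ (q (n + 1)) κ Y := by
      rcases hq (n + 1) with h | h
      · exact h
      obtain ⟨Y, hY, hYX⟩ := g.exists_extension hκ hf hM hκM hχ hV hX
      rw [← g.diag_self (n + 1)] at hY hYX
      exact ⟨_, (hX n le_rfl).splice
        (fun j hj => by rw [g.diag _ j (Nat.le_succ_of_le hj), g.diag n j hj])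
        (fun j hj => by rw [h j hj, g.diag_self]) hY hYX⟩
    refine ⟨update X (n + 1) Y, fun i hi => ?_⟩
    rcases hi.lt_or_eq with h | rfl
    · rw [update_of_ne h.ne]
      exact hX i (Nat.le_of_lt_succ h)
    · rwa [update_self]

theorem Grid.exists_contAlong (g : Grid z q (κ / 16)) (hκ : 0 < κ)
    (h : ∀ n, ∃ X : ℕ → ℕ → ℂ → A, ∀ i ≤ n, ContAlong χ (q i) κ (X i)) :
    ∃ X, ContAlong χ z κ X := by
  choose X hX using h
  have hdiag := fun j => hX j j le_rfl
  refine ⟨fun j => X j j j, fun j => ?_, (hdiag 0).start, fun j => ?_⟩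
  · rw [← g.diag_self j]
    exact (hdiag j).diff j
  · have htime := (hdiag (j + 1)).step j
    have hindex := g.eqOn_index_succ hκ (hdiag j) (hdiag (j + 1)) j
    rw [g.diag_self] at htime
    rw [g.diag_self, g.diag (j + 1) j (Nat.le_succ _), inter_self] at hindex
    exact htime.trans (hindex.eventuallyEq_of_mem (isOpen_ball.mem_nhds
      (mem_ball.2 (by linarith [g.dist_chain j])))).symm

variable {S T : Set (ℝ × ℂ)} {e η d Λ : ℝ} {θ : ℝ × ℂ → ℝ} {p : ℕ → ℝ × ℂ}

theorem grid_of_flow (hp : IsChain p) (hθ : IsCutoff S e θ) (he : 0 < e) (hθp : ∀ j, θ (p j) = 0)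
    (hκ : 0 ≤ κ) (hs : ∀ j, (p (j + 1)).1 - (p j).1 ≤ κ)
    (hκη : ∀ j, κ * Real.exp (e⁻¹ * (p j).1) < η) :
    Grid (fun j => (p j).2) (fun i j => (p j - flow θ p i j).2) η := by
  have hθ0 : θ 0 = 0 := by rw [← hp.zero, hθp]
  have hsη : ∀ j, (p (j + 1)).1 - (p j).1 < η := fun j =>
    (hs j).trans_lt (by simpa [hp.zero] using hκη 0)
  refine ⟨fun j => ?_, fun i j h => ?_, fun i => ?_, fun i j => ?_, fun i j => ?_, fun i j => ?_⟩
  · rw [flow_zero_index hp hθp, sub_self, Prod.snd_zero]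
  · rw [flow_of_le h, sub_zero]
  · simp [flow_succ le_rfl, flow_of_le le_rfl, hθ0]
  · exact (le_max_right _ _).trans_lt
      ((dist_sub_flow_succ_le hp hθ.mem_Icc i j).trans_lt (hsη j))
  · simp only [Prod.snd_sub, sub_sub_cancel]
    exact (le_max_right _ _).trans_lt ((dist_flow_succ_le hp hθ.mem_Icc i j).trans_lt (hsη j))
  · simp only [Prod.snd_sub, dist_sub_left]
    exact (le_max_right _ _).trans_lt
      ((dist_flow_index_succ_le hp hθ he hθ0 hκ hs i j).trans_lt (hκη j))

theorem exists_radius_forall_differentiableOn (hf : AnalyticAt ℂ f 0) (hχ : AnalyticAt ℂ χ 0)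
    {b : ℝ} (hb : 0 < b) :
    ∃ κ > 0, κ ≤ b ∧ DifferentiableOn ℂ f (ball 0 (2 * κ)) ∧ DifferentiableOn ℂ χ (ball 0 κ) ∧
      ∃ M, (∀ u ∈ ball 0 κ, ‖f u‖ ≤ M) ∧ κ * M < 1 := by
  obtain ⟨r, hr, hball⟩ := Metric.eventually_nhds_iff_ball.1 <|
    hf.eventually_analyticAt.and <| hχ.eventually_analyticAt.and <|
      hf.continuousAt.norm.eventually_lt (continuousAt_const (y := ‖f 0‖ + 1)) (lt_add_one _)
  have hM : 0 < ‖f 0‖ + 1 := by positivity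
  obtain ⟨κ, hκ, hκlt⟩ := exists_between
    (lt_min hb (lt_min (half_pos hr) (inv_pos.2 hM)) : (0 : ℝ) < min b (min (r / 2) _))
  obtain ⟨hκb, hκr, hκM⟩ : κ < b ∧ κ < r / 2 ∧ κ < (‖f 0‖ + 1)⁻¹ := by
    simpa only [lt_min_iff] using hκlt
  refine ⟨κ, hκ, hκb.le, fun u hu => ?_, fun u hu => ?_, ‖f 0‖ + 1, fun u hu => ?_, ?_⟩
  · exact (hball u (ball_subset_ball (by linarith) hu)).1.differentiableAt.differentiableWithinAt
  · exact (hball u (ball_subset_ball (by linarith) hu)).2.1.differentiableAt.differentiableWithinAt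
  · exact (hball u (ball_subset_ball (by linarith) hu)).2.2.le
  · exact (lt_inv_mul_iff₀' hM).1 (by simpa using hκM)

variable {δ : ℝ}

theorem ChainContMesh.of_resolvent (hS : ∀ s ∈ S, δ ≤ s.1) (hST : S ⊆ T)
    (hadd : ∀ s ∈ S, ∀ t ∈ T, s + t ∈ T) (hχ : ∀ᶠ ζ in 𝓝 0, χ ζ = f ζ + convFrom 0 χ f ζ)
    (he : 0 < e) (heδ : 8 * e ≤ δ) (hκ : 0 < κ) (hκe : κ ≤ e)
    (hf : DifferentiableOn ℂ f (ball 0 (2 * κ))) (hχd : DifferentiableOn ℂ χ (ball 0 κ))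
    (hM : ∀ u ∈ ball (0 : ℂ) κ, ‖f u‖ ≤ M) (hκM : κ * M < 1)
    (hfmesh : ChainContMesh S f (Λ + δ / 2) (e / 2) (2 * κ)) (hχmesh : ChainContMesh T χ Λ e κ) :
    ∃ κ' > 0, ChainContMesh T χ (Λ + δ / 2) (4 * e) κ' := by
  let L := e⁻¹ * |Λ + δ / 2|
  have hL : Real.exp (-L) ≤ 1 := Real.exp_le_one_iff.2 (neg_nonpos.2 (by positivity))
  refine ⟨κ / 32 * Real.exp (-L), by positivity, fun p hp hs hT hΛ => ?_⟩
  have hs' : ∀ j, (p (j + 1)).1 - (p j).1 ≤ κ / 32 := fun j =>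
    (hs j).le.trans (mul_le_of_le_one_right (by positivity) hL)
  obtain ⟨θ, hθ⟩ := exists_isCutoff S he
  have hθp : ∀ j, θ (p j) = 0 := fun j =>
    hθ.eq_zero_of_margin ((hT j).mono hST (by linarith))
  have hθd : ∀ x : ℝ × ℂ, x.1 ≤ δ / 2 → θ x = 0 := fun x hx =>
    hθ.eq_zero_of_fst_le hS (by linarith)
  have hS0 : Margin S e 0 := hp.zero ▸ (hT 0).mono hST (by linarith)
  have g : Grid (fun j => (p j).2) (fun i j => (p j - flow θ p i j).2) (κ / 16) := by
    refine grid_of_flow hp hθ he hθp (by positivity) (fun j => (hs j).le) fun j => ?_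
    calc κ / 32 * Real.exp (-L) * Real.exp (e⁻¹ * (p j).1)
        ≤ κ / 32 * Real.exp (-L) * Real.exp L := by
          gcongr
          exact mul_le_mul_of_nonneg_left ((hΛ j).trans (le_abs_self _)) (inv_nonneg.2 he.le)
      _ = κ / 32 := by rw [mul_assoc, ← Real.exp_add, neg_add_cancel, Real.exp_zero, mul_one]
      _ < κ / 16 := by linarith
  choose V hV using hfmesh.exists_contAlong_flow hp hθ hS0 he (fun j => by linarith [hs' j])
    (fun j => by linarith [hs' j]) hΛ
  have hq : ∀ i, (∃ Y, ContAlong χ (fun j => (p j - flow θ p i j).2) κ Y) ∨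
      ∀ j, i ≤ j → (p j - flow θ p i j).2 = (p i).2 := by
    intro i
    rcases le_or_gt (p i).1 Λ with hi | hi
    · exact .inl <| hχmesh.exists_contAlong_sub_flow hp hθ hadd he hθd
        (fun j => by linarith [hs' j]) (fun j => by linarith [hs' j]) hT hΛ hi
    · exact .inr fun j hj => by rw [sub_flow_eq_of_le hθd (fun k => by linarith [hΛ k]) hj]
  obtain ⟨X, hX⟩ := g.exists_contAlong hκ (g.exists_family hκ hf hM hκM hχd hχ hV hq)
  exact ⟨X, hX.mono ((mul_le_of_le_one_right (by positivity) hL).trans (by linarith))⟩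

theorem ChainCont.resolvent_add (hδ : 0 < δ) (hS : ∀ s ∈ S, δ ≤ s.1) (hST : S ⊆ T)
    (hadd : ∀ s ∈ S, ∀ t ∈ T, s + t ∈ T) (hf0 : AnalyticAt ℂ f 0) (hχ0 : AnalyticAt ℂ χ 0)
    (hχ : ∀ᶠ ζ in 𝓝 0, χ ζ = f ζ + convFrom 0 χ f ζ) (hf : ChainCont S f (Λ + δ / 2))
    (h : ChainCont T χ Λ) : ChainCont T χ (Λ + δ / 2) := by
  intro ε hε
  obtain ⟨e, he, heε, heδ⟩ : ∃ e > 0, 4 * e ≤ ε ∧ 8 * e ≤ δ :=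
    ⟨min (ε / 4) (δ / 8), lt_min (by linarith) (by linarith),
      by linarith [min_le_left (ε / 4) (δ / 8)], by linarith [min_le_right (ε / 4) (δ / 8)]⟩
  obtain ⟨κf, hκf, hfmesh⟩ := hf (e / 2) (by linarith)
  obtain ⟨κχ, hκχ, hχmesh⟩ := h e he
  obtain ⟨κ, hκ, hκle, hfd, hχd, M, hM, hκM⟩ :=
    exists_radius_forall_differentiableOn hf0 hχ0 (lt_min he (lt_min (half_pos hκf) hκχ))
  obtain ⟨hκe, hκκf, hκκχ⟩ : κ ≤ e ∧ κ ≤ κf / 2 ∧ κ ≤ κχ := by simpa only [le_min_iff] using hκle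
  obtain ⟨κ', hκ', hmesh⟩ := ChainContMesh.of_resolvent hS hST hadd hχ he heδ hκ hκe hfd hχd hM
    hκM (hfmesh.mono subset_rfl le_rfl le_rfl (by linarith))
    (hχmesh.mono subset_rfl le_rfl le_rfl hκκχ)
  exact ⟨κ', hκ', hmesh.mono subset_rfl le_rfl heε le_rfl⟩

theorem ChainCont.resolvent (hδ : 0 < δ) (hS : ∀ s ∈ S, δ ≤ s.1) (hST : S ⊆ T)
    (hadd : ∀ s ∈ S, ∀ t ∈ T, s + t ∈ T) (hf0 : AnalyticAt ℂ f 0) (hχ0 : AnalyticAt ℂ χ 0)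
    (hχ : ∀ᶠ ζ in 𝓝 0, χ ζ = f ζ + convFrom 0 χ f ζ) (hf : ∀ Λ, ChainCont S f Λ) (Λ : ℝ) :
    ChainCont T χ Λ := by
  have hstep : ∀ n : ℕ, ChainCont T χ (-1 + n * (δ / 2)) := by
    intro n
    induction n with
    | zero =>
      refine fun ε _ => ⟨1, one_pos, fun p hp _ _ hl => ?_⟩
      have hneg : (p 0).1 ≤ -1 := by simpa using hl 0
      linarith [hp.nonneg 0]
    | succ n ih =>
      rw [Nat.cast_succ, add_mul, one_mul, ← add_assoc]
      exact (hf _).resolvent_add hδ hS hST hadd hf0 hχ0 hχ ih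
  obtain ⟨n, hn⟩ := exists_nat_gt ((Λ + 1) / (δ / 2))
  rw [div_lt_iff₀ (by linarith)] at hn
  exact (hstep n).mono subset_rfl (by linarith)

end Resolvent

section GermCont

/-- The germs `g t` at `γ t`, for `t ∈ I`, continue each other analytically along `γ`. -/
structure GermCont (γ : ℝ → ℂ) (I : Set ℝ) (g : ℝ → ℂ → ℂ) : Prop where
  analytic : ∀ t ∈ I, AnalyticAt ℂ (g t) (γ t)
  local_eq : ∀ t ∈ I, ∀ᶠ s in 𝓝[I] t, g s =ᶠ[𝓝 (γ s)] g t

theorem continuableAlong_iff {f : ℂ → ℂ} {γ : LipPath} : ContinuableAlong f γ ↔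
    ∃ g, GermCont γ.toFun (Icc 0 γ.tEnd) g ∧ g 0 =ᶠ[𝓝 0] f :=
  ⟨fun ⟨g, ha, h0, hl⟩ => ⟨g, ⟨ha, hl⟩, h0⟩, fun ⟨g, ⟨ha, hl⟩, h0⟩ => ⟨g, ha, h0, hl⟩⟩

variable {γ γ' : ℝ → ℂ} {I J : Set ℝ} {g g' : ℝ → ℂ → ℂ}

theorem GermCont.comp (h : GermCont γ I g) {φ : ℝ → ℝ} (hφ : ContinuousOn φ J)
    (hJ : MapsTo φ J I) : GermCont (γ ∘ φ) J (g ∘ φ) :=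
  ⟨fun _ ht => h.analytic _ (hJ ht), fun t ht =>
    ((hφ t ht).tendsto_nhdsWithin hJ).eventually (h.local_eq _ (hJ ht))⟩

theorem GermCont.mono (h : GermCont γ I g) (hJ : J ⊆ I) : GermCont γ J g :=
  h.comp continuousOn_id hJ

theorem GermCont.congr (h : GermCont γ I g) (he : EqOn γ γ' I) : GermCont γ' I g := by
  refine ⟨fun t ht => he ht ▸ h.analytic t ht, fun t ht => ?_⟩
  filter_upwards [h.local_eq t ht, self_mem_nhdsWithin] with s hs hsI
  rwa [← he hsI]

theorem exists_differentiableOn_ball {E : Type*} [NormedAddCommGroup E] [NormedSpace ℂ E]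
    [CompleteSpace E] {X : ℂ → E} {z : ℂ} (hX : AnalyticAt ℂ X z) :
    ∃ r > 0, DifferentiableOn ℂ X (ball z r) := by
  obtain ⟨r, hr, hb⟩ := Metric.eventually_nhds_iff_ball.1 hX.eventually_analyticAt
  exact ⟨r, hr, fun u hu => (hb u hu).differentiableAt.differentiableWithinAt⟩

theorem GermCont.unique (h : GermCont γ I g) (h' : GermCont γ I g') (hI : IsPreconnected I)
    (hγ : ContinuousOn γ I) {a t : ℝ} (ha : a ∈ I) (ht : t ∈ I) (e : g a =ᶠ[𝓝 (γ a)] g' a) :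
    g t =ᶠ[𝓝 (γ t)] g' t := by
  refine hI.induction₂' (fun s t => g s =ᶠ[𝓝 (γ s)] g' s → g t =ᶠ[𝓝 (γ t)] g' t) ?_
    (fun x y z _ _ _ h1 h2 h3 => h2 (h1 h3)) ha ht e
  intro t ht
  obtain ⟨r, hr, hb⟩ := Metric.eventually_nhds_iff_ball.1
    ((h.analytic t ht).eventually_analyticAt.and (h'.analytic t ht).eventually_analyticAt)
  have hd : DifferentiableOn ℂ (g t) (ball (γ t) r) := fun u hu =>
    (hb u hu).1.differentiableAt.differentiableWithinAt
  have hd' : DifferentiableOn ℂ (g' t) (ball (γ t) r) := fun u hu =>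
    (hb u hu).2.differentiableAt.differentiableWithinAt
  have hext {u : ℂ} := eqOn_of_eventuallyEq (z := u) isOpen_ball (convex_ball _ _).isPreconnected
    hd hd'
  filter_upwards [h.local_eq t ht, h'.local_eq t ht, hγ t ht (ball_mem_nhds _ hr)]
    with s hs hs' hsb
  refine ⟨fun e => ?_, fun e => ?_⟩
  · exact (hs.trans ((hext (mem_ball_self hr) e).eventuallyEq_of_mem
      (isOpen_ball.mem_nhds hsb))).trans hs'.symm
  · exact (hext hsb ((hs.symm.trans e).trans hs')).eventuallyEq_of_mem (ball_mem_nhds _ hr)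

theorem GermCont.eventuallyEq_of_mapsTo (h : GermCont γ I g) (hI : IsPreconnected I)
    (hγ : ContinuousOn γ I) {X : ℂ → ℂ} {U : Set ℂ} (hU : IsOpen U) (hX : DifferentiableOn ℂ X U)
    (hm : MapsTo γ I U) {a t : ℝ} (ha : a ∈ I) (ht : t ∈ I) (e : g a =ᶠ[𝓝 (γ a)] X) :
    g t =ᶠ[𝓝 (γ t)] X :=
  h.unique (g' := fun _ => X) ⟨fun _ ht => hX.analyticAt (hU.mem_nhds (hm ht)),
    fun _ _ => .of_forall fun _ => EventuallyEq.rfl⟩ hI hγ ha ht e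

theorem GermCont.eventually_eventuallyEq {W : Type*} [TopologicalSpace W] {Γ : W → ℝ → ℂ}
    (hΓ : Continuous (uncurry Γ)) {h : W → ℝ → ℂ → ℂ} {w₀ : W} (hI : I.OrdConnected)
    (hg : ∀ᶠ w in 𝓝 w₀, GermCont (Γ w) I (h w)) {a t : ℝ} (ha : a ∈ I) (ht : t ∈ I)
    (e : ∀ᶠ w in 𝓝 w₀, h w a =ᶠ[𝓝 (Γ w a)] h w₀ a) :
    ∀ᶠ w in 𝓝 w₀, h w t =ᶠ[𝓝 (Γ w t)] h w₀ t := by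
  refine hI.isPreconnected.induction₂' (fun s t => (∀ᶠ w in 𝓝 w₀, h w s =ᶠ[𝓝 (Γ w s)] h w₀ s) →
    ∀ᶠ w in 𝓝 w₀, h w t =ᶠ[𝓝 (Γ w t)] h w₀ t) ?_ (fun x y z _ _ _ h1 h2 h3 => h2 (h1 h3)) ha ht e
  intro s hs
  obtain ⟨r, hr, hd⟩ := exists_differentiableOn_ball (hg.self_of_nhds.analytic s hs)
  have hnear : ∀ᶠ q in 𝓝 w₀ ×ˢ 𝓝 s, Γ q.1 q.2 ∈ ball (Γ w₀ s) r := by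
    rw [← nhds_prod_eq]
    exact hΓ.continuousAt.eventually_mem (ball_mem_nhds _ hr)
  obtain ⟨P, hP, Q, hQ, hPQ⟩ := eventually_prod_iff.1 hnear
  obtain ⟨η, hη, hQη⟩ := Metric.eventually_nhds_iff_ball.1 hQ
  filter_upwards [hg.self_of_nhds.local_eq s hs, self_mem_nhdsWithin,
    nhdsWithin_le_nhds (ball_mem_nhds s hη)] with s' hs' hsI hsη
  have hJ : uIcc s s' ⊆ I ∩ ball s η := by
    rw [← segment_eq_uIcc]
    exact subset_inter (hI.convex.segment_subset hs hsI)
      ((convex_ball s η).segment_subset (mem_ball_self hη) hsη)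
  have hloc : ∀ᶠ w in 𝓝 w₀, ∀ a ∈ uIcc s s', ∀ b ∈ uIcc s s',
      h w a =ᶠ[𝓝 (Γ w a)] h w₀ s → h w b =ᶠ[𝓝 (Γ w b)] h w₀ s := by
    filter_upwards [hg, hP] with w hw hwP a ha b hb
    exact (hw.mono fun τ hτ => (hJ hτ).1).eventuallyEq_of_mapsTo isPreconnected_uIcc
      (hΓ.uncurry_left w).continuousOn isOpen_ball hd (fun τ hτ => hPQ hwP (hQη τ (hJ hτ).2)) ha hb
  have hend : ∀ᶠ w in 𝓝 w₀, h w₀ s' =ᶠ[𝓝 (Γ w s')] h w₀ s :=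
    (hΓ.uncurry_right s').continuousAt.eventually hs'.eventually_nhds
  refine ⟨fun H => ?_, fun H => ?_⟩
  · filter_upwards [H, hloc, hend] with w hw hl hw'
    exact (hl s left_mem_uIcc s' right_mem_uIcc hw).trans hw'.symm
  · filter_upwards [H, hloc, hend] with w hw hl hw'
    exact hl s' right_mem_uIcc s left_mem_uIcc (hw.trans hw')

theorem exists_extension_ball {z : ℂ} {ε : ℝ} (hε : 0 < ε) {X₀ : ℂ → ℂ} {h : ℂ → ℝ → ℂ → ℂ}
    (hg : ∀ w ∈ ball z ε, GermCont (AffineMap.lineMap z w) (Icc 0 1) (h w))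
    (h0 : ∀ w ∈ ball z ε, h w 0 =ᶠ[𝓝 z] X₀) :
    ∃ X : ℂ → ℂ, DifferentiableOn ℂ X (ball z ε) ∧ X =ᶠ[𝓝 z] X₀ ∧
      ∀ w ∈ ball z ε, h w 1 =ᶠ[𝓝 w] X := by
  have h01 : (0 : ℝ) ∈ Icc (0 : ℝ) 1 := left_mem_Icc.2 zero_le_one
  have h11 : (1 : ℝ) ∈ Icc (0 : ℝ) 1 := right_mem_Icc.2 zero_le_one
  have hΓ : Continuous (uncurry fun (w : ℂ) (s : ℝ) => AffineMap.lineMap z w s) := by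
    simp only [uncurry_def, AffineMap.lineMap_apply_module]
    fun_prop
  have hX : ∀ w ∈ ball z ε, h w 1 =ᶠ[𝓝 w] fun u => h u 1 u := by
    intro w hw
    have hnear : ∀ᶠ u in 𝓝 w, u ∈ ball z ε := isOpen_ball.mem_nhds hw
    have hdiag := GermCont.eventually_eventuallyEq hΓ ordConnected_Icc (hnear.mono hg) h01 h11
      (hnear.mono fun u hu => by
        simpa only [AffineMap.lineMap_apply_zero] using (h0 u hu).trans (h0 w hw).symm)
    simp only [AffineMap.lineMap_apply_one] at hdiag
    exact hdiag.mono fun u hu => hu.eq_of_nhds.symm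
  refine ⟨fun u => h u 1 u, fun w hw => ?_, ?_, hX⟩
  · have hw1 : AnalyticAt ℂ (h w 1) w := by
      simpa only [AffineMap.lineMap_apply_one] using (hg w hw).analytic 1 h11
    exact (hw1.congr (hX w hw)).differentiableAt.differentiableWithinAt
  · have hz : z ∈ ball z ε := mem_ball_self hε
    have hgz : GermCont (fun _ => z) (Icc 0 1) (h z) := (hg z hz).congr fun s _ => by simp
    obtain ⟨r, hr, hd⟩ := exists_differentiableOn_ball (hgz.analytic 0 h01)
    have h10 : h z 1 =ᶠ[𝓝 z] h z 0 := hgz.eventuallyEq_of_mapsTo isPreconnected_Icc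
      continuousOn_const isOpen_ball hd (fun _ _ => mem_ball_self hr) h01 h11 EventuallyEq.rfl
    exact ((hX z hz).symm.trans h10).trans (h0 z hz)

end GermCont

section Length

theorem eVariationOn_Icc_le {f : ℝ → ℂ} {K : ℝ≥0} {a b : ℝ} (hab : a ≤ b)
    (hf : LipschitzOnWith K f (Icc a b)) :
    eVariationOn f (Icc a b) ≤ ENNReal.ofReal (K * (b - a)) := by
  have hid := (monotoneOn_id (s := Icc a b)).eVariationOn_eq (left_mem_Icc.2 hab)
    (right_mem_Icc.2 hab)
  rw [inter_self] at hid
  calc eVariationOn f (Icc a b)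
      ≤ K * eVariationOn id (Icc a b) := hf.comp_eVariationOn_le (mapsTo_id _)
    _ = ENNReal.ofReal (K * (b - a)) := by
      rw [hid, ENNReal.ofReal_mul K.coe_nonneg, ENNReal.ofReal_coe_nnreal, id, id]

variable {γ : LipPath} {s t : ℝ}

theorem LipPath.continuousOn (γ : LipPath) : ContinuousOn γ.toFun (Icc 0 γ.tEnd) := by
  obtain ⟨K, hK⟩ := γ.lipschitz
  exact hK.continuousOn

theorem LipPath.eVariationOn_ne_top (hs : 0 ≤ s) (hst : s ≤ t) (ht : t ≤ γ.tEnd) :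
    eVariationOn γ.toFun (Icc s t) ≠ ⊤ := by
  obtain ⟨K, hK⟩ := γ.lipschitz
  exact ((eVariationOn_Icc_le hst (hK.mono (Icc_subset_Icc hs ht))).trans_lt
    ENNReal.ofReal_lt_top).ne

theorem LipPath.lengthUpTo_zero : γ.lengthUpTo 0 = 0 := by
  rw [LipPath.lengthUpTo, Icc_self, eVariationOn.subsingleton _ subsingleton_singleton,
    ENNReal.toNNReal_zero]

theorem LipPath.lengthUpTo_sub (hs : 0 ≤ s) (hst : s ≤ t) (ht : t ≤ γ.tEnd) :
    (γ.lengthUpTo t : ℝ) - γ.lengthUpTo s = (eVariationOn γ.toFun (Icc s t)).toReal := by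
  have hadd := eVariationOn.Icc_add_Icc γ.toFun (s := univ) hs hst (mem_univ s)
  simp only [univ_inter] at hadd
  rw [LipPath.lengthUpTo, LipPath.lengthUpTo, ENNReal.coe_toNNReal_eq_toReal,
    ENNReal.coe_toNNReal_eq_toReal, ← hadd, ENNReal.toReal_add
      (LipPath.eVariationOn_ne_top le_rfl hs (hst.trans ht))
      (LipPath.eVariationOn_ne_top hs hst ht), add_sub_cancel_left]

theorem LipPath.dist_le_lengthUpTo_sub (hs : 0 ≤ s) (hst : s ≤ t) (ht : t ≤ γ.tEnd) :
    dist (γ.toFun t) (γ.toFun s) ≤ γ.lengthUpTo t - γ.lengthUpTo s := by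
  rw [LipPath.lengthUpTo_sub hs hst ht,
    ← ENNReal.ofReal_le_iff_le_toReal (LipPath.eVariationOn_ne_top hs hst ht), ← edist_dist]
  exact eVariationOn.edist_le γ.toFun (right_mem_Icc.2 hst) (left_mem_Icc.2 hst)

theorem LipPath.lengthUpTo_mono (hs : 0 ≤ s) (hst : s ≤ t) (ht : t ≤ γ.tEnd) :
    (γ.lengthUpTo s : ℝ) ≤ γ.lengthUpTo t :=
  sub_nonneg.1 (dist_nonneg.trans (LipPath.dist_le_lengthUpTo_sub hs hst ht))

theorem LipPath.lengthUpTo_sub_le {K : ℝ≥0} (hs : 0 ≤ s) (hst : s ≤ t) (ht : t ≤ γ.tEnd)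
    (hK : LipschitzOnWith K γ.toFun (Icc s t)) :
    (γ.lengthUpTo t : ℝ) - γ.lengthUpTo s ≤ K * (t - s) := by
  rw [LipPath.lengthUpTo_sub hs hst ht]
  exact ENNReal.toReal_le_of_le_ofReal (mul_nonneg K.coe_nonneg (sub_nonneg.2 hst))
    (eVariationOn_Icc_le hst hK)

theorem LipPath.continuousOn_lengthUpTo (γ : LipPath) :
    ContinuousOn γ.lengthUpTo (Icc 0 γ.tEnd) := by
  obtain ⟨K, hK⟩ := γ.lipschitz
  refine (LipschitzOnWith.of_dist_le_mul (K := K) fun s hs t ht => ?_).continuousOn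
  wlog hst : s ≤ t generalizing s t
  · rw [dist_comm, dist_comm s]
    exact this t ht s hs (le_of_not_ge hst)
  rw [NNReal.dist_eq, dist_comm, Real.dist_eq, abs_sub_comm, abs_of_nonneg (sub_nonneg.2 hst),
    abs_of_nonneg (sub_nonneg.2 (LipPath.lengthUpTo_mono hs.1 hst ht.2))]
  exact LipPath.lengthUpTo_sub_le hs.1 hst ht.2 (hK.mono (Icc_subset_Icc hs.1 ht.2))

end Length

section RealGraph

/-- The set `S_Ω` of a discrete filtered set, viewed in the normed space `ℝ × ℂ`. -/
def DFS.realGraph (Ω : DFS) : Set (ℝ × ℂ) :=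
  (fun p : ℝ≥0 × ℂ => ((p.1 : ℝ), p.2)) '' Ω.graph

theorem DFS.mem_realGraph {Ω : DFS} {L : ℝ≥0} {ω : ℂ} (h : ω ∈ Ω.carrier L) :
    ((L : ℝ), ω) ∈ Ω.realGraph :=
  ⟨(L, ω), h, rfl⟩

variable {Ω : DFS} {ε : ℝ}

theorem DFS.mem_allowed_of_margin (hε : 0 < ε) {l : ℝ≥0} {z : ℂ}
    (h : Margin Ω.realGraph ε (l, z)) : (l, z) ∈ Ω.allowed := by
  intro hc
  obtain ⟨s, hs, hd⟩ := Metric.mem_closure_iff.1 hc ε hε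
  exact (h _ (DFS.mem_realGraph hs)).not_gt hd

theorem DFS.margin_of_le {l l' : ℝ} {z : ℂ} (h : Margin Ω.realGraph ε (l, z)) (hl : l' ≤ l) :
    Margin Ω.realGraph ε (l', z) := by
  rintro _ ⟨⟨L, ω⟩, hω, rfl⟩
  have hshift := h _ (DFS.mem_realGraph (Ω.mono' L (L + (l - l').toNNReal) le_self_add hω))
  rw [Prod.dist_eq, NNReal.coe_add, Real.coe_toNNReal _ (sub_nonneg.2 hl), Real.dist_eq,
    show l - (L + (l - l')) = l' - L by ring] at hshift
  rwa [Prod.dist_eq, Real.dist_eq]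

theorem LipPath.IsAllowed.exists_margin {γ : LipPath} (h : γ.IsAllowed Ω) :
    ∃ ε > 0, ∀ t ∈ Icc 0 γ.tEnd, Margin Ω.realGraph ε (γ.lengthUpTo t, γ.toFun t) := by
  let Γ : ℝ → ℝ≥0 × ℂ := fun t => (γ.lengthUpTo t, γ.toFun t)
  have hK : IsCompact (Γ '' Icc 0 γ.tEnd) :=
    isCompact_Icc.image_of_continuousOn (γ.continuousOn_lengthUpTo.prodMk γ.continuousOn)
  have hdisj : Disjoint (Γ '' Icc 0 γ.tEnd) (closure Ω.graph) := by
    rw [disjoint_left]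
    rintro _ ⟨t, ht, rfl⟩
    exact h t ht
  obtain ⟨ε, hε, hthick⟩ := hdisj.exists_thickenings hK isClosed_closure
  refine ⟨ε, hε, ?_⟩
  rintro t ht _ ⟨s, hs, rfl⟩
  by_contra! hlt
  exact disjoint_left.1 hthick (self_subset_thickening hε _ (mem_image_of_mem Γ ht))
    (mem_thickening_iff.2 ⟨s, subset_closure hs, hlt⟩)

end RealGraph

section Extend

/-- The path `γ` followed by the segment from its end point to `w`. -/
def LipPath.extend (γ : LipPath) (w : ℂ) : LipPath where
  toFun t := max (t - γ.tEnd) 0 • (w - γ.toFun γ.tEnd) + γ.toFun (min t γ.tEnd)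
  tEnd := γ.tEnd + 1
  tEnd_nonneg := by linarith [γ.tEnd_nonneg]
  lipschitz := by
    obtain ⟨K, hK⟩ := γ.lipschitz
    have hpath : LipschitzOnWith (K * 1) (fun t => γ.toFun (min t γ.tEnd))
        (Icc 0 (γ.tEnd + 1)) :=
      hK.comp (LipschitzWith.id.min_const γ.tEnd).lipschitzOnWith
        fun t ht => ⟨le_min ht.1 γ.tEnd_nonneg, min_le_right _ _⟩
    have hsegment : LipschitzWith _ (fun t : ℝ => max (t - γ.tEnd) 0 • (w - γ.toFun γ.tEnd)) :=
      (ContinuousLinearMap.toSpanSingleton ℝ (w - γ.toFun γ.tEnd)).lipschitz.comp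
        ((LipschitzWith.of_dist_le_mul (K := 1) fun s t => by
          simp [Real.dist_eq]).max_const 0)
    exact ⟨_, hsegment.lipschitzOnWith.add hpath⟩
  map_zero := by
    rw [min_eq_left γ.tEnd_nonneg, γ.map_zero, max_eq_right (by linarith [γ.tEnd_nonneg]),
      zero_smul, zero_add]

variable {γ : LipPath} {w : ℂ} {t : ℝ}

theorem LipPath.extend_of_le (ht : t ≤ γ.tEnd) : (γ.extend w).toFun t = γ.toFun t := by
  simp only [LipPath.extend, min_eq_left ht, max_eq_right (sub_nonpos.2 ht), zero_smul, zero_add]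

theorem LipPath.extend_of_ge (ht : γ.tEnd ≤ t) :
    (γ.extend w).toFun t = AffineMap.lineMap (γ.toFun γ.tEnd) w (t - γ.tEnd) := by
  simp only [LipPath.extend, min_eq_right ht, max_eq_left (sub_nonneg.2 ht),
    AffineMap.lineMap_apply, vsub_eq_sub, vadd_eq_add]

theorem LipPath.extend_tEnd : (γ.extend w).toFun (γ.tEnd + 1) = w := by
  rw [LipPath.extend_of_ge (le_add_of_nonneg_right zero_le_one), add_sub_cancel_left,
    AffineMap.lineMap_apply_one]

theorem LipPath.lengthUpTo_extend_of_le (ht : t ≤ γ.tEnd) :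
    (γ.extend w).lengthUpTo t = γ.lengthUpTo t :=
  congrArg ENNReal.toNNReal (eVariationOn.congr fun _ hs => LipPath.extend_of_le (hs.2.trans ht))

theorem LipPath.lengthUpTo_extend_of_ge (ht : γ.tEnd ≤ t) (ht' : t ≤ γ.tEnd + 1) :
    ((γ.extend w).lengthUpTo t : ℝ) ≤
      γ.lengthUpTo γ.tEnd + (t - γ.tEnd) * dist (γ.toFun γ.tEnd) w := by
  have hlip : LipschitzOnWith (nndist (γ.toFun γ.tEnd) w) (γ.extend w).toFun (Icc γ.tEnd t) :=
    LipschitzOnWith.of_dist_le_mul fun s hs s' hs' => by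
      rw [LipPath.extend_of_ge hs.1, LipPath.extend_of_ge hs'.1, dist_lineMap_lineMap,
        dist_sub_right, mul_comm, coe_nndist]
  have hsub := LipPath.lengthUpTo_sub_le γ.tEnd_nonneg ht ht' hlip
  rw [LipPath.lengthUpTo_extend_of_le le_rfl, coe_nndist, mul_comm] at hsub
  linarith

theorem LipPath.IsAllowed.extend {Ω : DFS} (h : γ.IsAllowed Ω) {ε l : ℝ}
    (hl : (γ.lengthUpTo γ.tEnd : ℝ) ≤ l) (hm : Margin Ω.realGraph ε (l, γ.toFun γ.tEnd))
    (hw : w ∈ ball (γ.toFun γ.tEnd) ε) : (γ.extend w).IsAllowed Ω := by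
  intro t ht
  rcases le_total t γ.tEnd with hle | hge
  · rw [LipPath.lengthUpTo_extend_of_le hle, LipPath.extend_of_le hle]
    exact h t ⟨ht.1, hle⟩
  · have hlen := LipPath.lengthUpTo_extend_of_ge (w := w) hge ht.2
    have ht1 : t - γ.tEnd ≤ 1 := sub_le_iff_le_add'.2 ht.2
    set d := dist (γ.toFun γ.tEnd) w
    have hmargin : Margin Ω.realGraph (ε - d)
        (l + (t - γ.tEnd) * d, (γ.extend w).toFun t) := by
      refine hm.of_dist_le ?_ (sub_add_cancel ε d).le
      rw [Prod.dist_eq, Real.dist_eq, LipPath.extend_of_ge hge, dist_lineMap_left,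
        add_sub_cancel_left, Real.norm_eq_abs, abs_mul, abs_of_nonneg (dist_nonneg (x := _)),
        abs_of_nonneg (sub_nonneg.2 hge), max_self]
      exact mul_le_of_le_one_left dist_nonneg ht1
    exact DFS.mem_allowed_of_margin (sub_pos.2 (mem_ball'.1 hw))
      (DFS.margin_of_le hmargin (by linarith))

theorem GermCont.of_extend_left {H : ℝ → ℂ → ℂ}
    (h : GermCont (γ.extend w).toFun (Icc 0 (γ.tEnd + 1)) H) :
    GermCont γ.toFun (Icc 0 γ.tEnd) H :=
  (h.mono (Icc_subset_Icc_right (by linarith))).congr fun _ ht => LipPath.extend_of_le ht.2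

theorem GermCont.of_extend_right {H : ℝ → ℂ → ℂ}
    (h : GermCont (γ.extend w).toFun (Icc 0 (γ.tEnd + 1)) H) :
    GermCont (AffineMap.lineMap (γ.toFun γ.tEnd) w) (Icc 0 1) fun s => H (γ.tEnd + s) := by
  have hT := γ.tEnd_nonneg
  refine (h.comp (φ := fun s => γ.tEnd + s) (by fun_prop) fun s hs =>
    ⟨by linarith [hs.1], by linarith [hs.2]⟩).congr fun s hs => ?_
  rw [comp_apply, LipPath.extend_of_ge (by linarith [hs.1]), add_sub_cancel_left]

end Extend

section ChainOfPath

/-- The germ of `f` at `0` continues to the germ of `g` at `z` along some `Ω`-allowed path of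
length at most `l`. -/
def Reach (Ω : DFS) (f : ℂ → ℂ) (z : ℂ) (l : ℝ) (g : ℂ → ℂ) : Prop :=
  ∃ γ : LipPath, γ.IsAllowed Ω ∧ γ.toFun γ.tEnd = z ∧ (γ.lengthUpTo γ.tEnd : ℝ) ≤ l ∧
    ∃ G, GermCont γ.toFun (Icc 0 γ.tEnd) G ∧ G 0 =ᶠ[𝓝 0] f ∧ G γ.tEnd =ᶠ[𝓝 z] g

variable {Ω : DFS} {f : ℂ → ℂ}

theorem Reach.mono {z : ℂ} {l l' : ℝ} {g : ℂ → ℂ} (h : Reach Ω f z l g) (hl : l ≤ l') :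
    Reach Ω f z l' g :=
  let ⟨γ, hγ, hz, hlen, hG⟩ := h
  ⟨γ, hγ, hz, hlen.trans hl, hG⟩

theorem Reach.of_analyticAt (hf : AnalyticAt ℂ f 0) {ε : ℝ} (hε : 0 < ε)
    (hm : Margin Ω.realGraph ε 0) : Reach Ω f 0 0 f := by
  let γ : LipPath := ⟨fun _ => 0, 0, le_rfl, ⟨0, (LipschitzWith.const 0).lipschitzOnWith⟩, rfl⟩
  have hlen : (γ.lengthUpTo γ.tEnd : ℝ) ≤ 0 := by
    simp only [γ, LipPath.lengthUpTo_zero, NNReal.coe_zero, le_rfl]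
  refine ⟨γ, fun t ht => ?_, rfl, hlen, fun _ => f,
    ⟨fun _ _ => hf, fun _ _ => .of_forall fun _ => EventuallyEq.rfl⟩, EventuallyEq.rfl,
    EventuallyEq.rfl⟩
  obtain rfl : t = 0 := le_antisymm ht.2 ht.1
  rw [LipPath.lengthUpTo_zero]
  exact DFS.mem_allowed_of_margin hε hm

theorem Reach.exists_ball (hf : ∀ γ : LipPath, γ.IsAllowed Ω → ContinuableAlong f γ) {z : ℂ}
    {l ε : ℝ} {g : ℂ → ℂ} (h : Reach Ω f z l g) (hε : 0 < ε)
    (hm : Margin Ω.realGraph ε (l, z)) :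
    ∃ X : ℂ → ℂ, DifferentiableOn ℂ X (ball z ε) ∧ X =ᶠ[𝓝 z] g ∧
      ∀ w ∈ ball z ε, Reach Ω f w (l + dist z w) X := by
  obtain ⟨γ, hγ, rfl, hl, G, hG, hG0, hGg⟩ := h
  have hall : ∀ w ∈ ball (γ.toFun γ.tEnd) ε, (γ.extend w).IsAllowed Ω := fun w hw =>
    hγ.extend hl hm hw
  choose! H hH hH0 using fun w hw => continuableAlong_iff.1 (hf _ (hall w hw))
  have hstart : ∀ w ∈ ball (γ.toFun γ.tEnd) ε, H w (γ.tEnd + 0) =ᶠ[𝓝 (γ.toFun γ.tEnd)] g := by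
    intro w hw
    rw [add_zero]
    refine ((hH w hw).of_extend_left.unique hG isPreconnected_Icc γ.continuousOn
      (left_mem_Icc.2 γ.tEnd_nonneg) (right_mem_Icc.2 γ.tEnd_nonneg) ?_).trans hGg
    rw [γ.map_zero]
    exact (hH0 w hw).trans hG0.symm
  obtain ⟨X, hXd, hXg, hX⟩ := exists_extension_ball hε (fun w hw => (hH w hw).of_extend_right)
    hstart
  refine ⟨X, hXd, hXg, fun w hw => ⟨γ.extend w, hall w hw, LipPath.extend_tEnd, ?_, H w,
    hH w hw, hH0 w hw, hX w hw⟩⟩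
  have hlen := LipPath.lengthUpTo_extend_of_ge (γ := γ) (w := w)
    (le_add_of_nonneg_right zero_le_one) le_rfl
  rw [add_sub_cancel_left, one_mul] at hlen
  exact hlen.trans (by linarith)

theorem exists_seq_of_forall_exists_succ {α : Type*} {P : ℕ → α → Prop} {R : ℕ → α → α → Prop}
    {a : α} (ha : P 0 a) (h : ∀ n a, P n a → ∃ b, P (n + 1) b ∧ R n a b) :
    ∃ u : ℕ → α, u 0 = a ∧ (∀ n, P n (u n)) ∧ ∀ n, R n (u n) (u (n + 1)) := by
  choose! b hb hR using h
  let u : ∀ n, {a // P n a} := fun n => Nat.rec ⟨a, ha⟩ (fun n x => ⟨b n x, hb n x x.2⟩) n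
  exact ⟨fun n => (u n).1, rfl, fun n => (u n).2, fun n => hR n (u n).1 (u n).2⟩

theorem chainCont_of_continuableAlong (hf0 : AnalyticAt ℂ f 0)
    (hf : ∀ γ : LipPath, γ.IsAllowed Ω → ContinuableAlong f γ) (Λ : ℝ) :
    ChainCont Ω.realGraph f Λ := by
  intro ε hε
  refine ⟨ε, hε, fun p hp hs hm _ => ?_⟩
  have hm0 : Margin Ω.realGraph ε 0 := hp.zero ▸ hm 0
  obtain ⟨X₀, hX₀, hX₀f, hreach₀⟩ := (Reach.of_analyticAt hf0 hε hm0).exists_ball hf hε hm0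
  obtain ⟨X, hX0, hX, hstep⟩ := exists_seq_of_forall_exists_succ (a := X₀)
    (P := fun j X => DifferentiableOn ℂ X (ball (p j).2 ε) ∧
      ∀ w ∈ ball (p j).2 ε, Reach Ω f w ((p j).1 + dist (p j).2 w) X)
    (R := fun j X Y => Y =ᶠ[𝓝 (p (j + 1)).2] X) (by rw [hp.zero]; exact ⟨hX₀, hreach₀⟩)
    fun j X ⟨_, hreach⟩ => by
      have hdist := hp.step j
      obtain ⟨Y, hY, hYX, hreachY⟩ := ((hreach (p (j + 1)).2 (hdist.trans_lt (hs j))).mono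
        (by linarith [dist_comm (p j).2 (p (j + 1)).2])).exists_ball hf hε (hm (j + 1))
      exact ⟨Y, ⟨hY, hreachY⟩, hYX⟩
  exact ⟨X, fun j => (hX j).1, hX0 ▸ hX₀f, hstep⟩

end ChainOfPath

section PathOfChain

theorem LipPath.isChain {γ : LipPath} {t : ℕ → ℝ} (ht : Monotone t) (h0 : t 0 = 0)
    (hT : ∀ j, t j ≤ γ.tEnd) : IsChain fun j => ((γ.lengthUpTo (t j) : ℝ), γ.toFun (t j)) where
  zero := by
    rw [h0, LipPath.lengthUpTo_zero, γ.map_zero]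
    rfl
  step j := LipPath.dist_le_lengthUpTo_sub (h0 ▸ ht j.zero_le) (ht j.le_succ) (hT _)

theorem ContAlong.germCont {f : ℂ → ℂ} {γ : ℝ → ℂ} {K : ℝ≥0} {h κ : ℝ} {X : ℕ → ℂ → ℂ}
    (hh : 0 < h) (hKh : K * h < κ) (hγ : LipschitzOnWith K γ (Ici 0))
    (hX : ContAlong f (fun j => γ (j * h)) κ X) : GermCont γ (Ici 0) fun s => X ⌊s / h⌋₊ := by
  have hnear : ∀ (j : ℕ) (s : ℝ), 0 ≤ s → |s - j * h| ≤ h → γ s ∈ ball (γ (j * h)) κ :=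
    fun j s hs hsj => (hγ.dist_le_mul s hs _ (mem_Ici.2 (by positivity))).trans_lt
      ((mul_le_mul_of_nonneg_left hsj K.coe_nonneg).trans_lt hKh)
  have hfloor : ∀ s, 0 ≤ s → ⌊s / h⌋₊ * h ≤ s ∧ s < (⌊s / h⌋₊ + 1) * h := fun s hs =>
    ⟨(le_div_iff₀ hh).1 (Nat.floor_le (by positivity)),
      (div_lt_iff₀ hh).1 (Nat.lt_floor_add_one _)⟩
  refine ⟨fun s hs => ?_, fun s hs => ?_⟩
  · obtain ⟨hlo, hhi⟩ := hfloor s hs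
    exact (hX.diff _).analyticAt (isOpen_ball.mem_nhds
      (hnear _ s hs (abs_le.2 ⟨by linarith, by linarith⟩)))
  obtain ⟨hlo, hhi⟩ := hfloor s hs
  filter_upwards [self_mem_nhdsWithin, nhdsWithin_le_nhds (isOpen_Ioo.mem_nhds
    (⟨by linarith, hhi⟩ : s ∈ Ioo ((⌊s / h⌋₊ - 1) * h) ((⌊s / h⌋₊ + 1) * h)))] with u hu hus
  obtain ⟨hulo, huhi⟩ := hfloor u hu
  have hle : (⌊u / h⌋₊ : ℝ) < ⌊s / h⌋₊ + 1 := lt_of_mul_lt_mul_right (hulo.trans_lt hus.2) hh.le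
  have hge : (⌊s / h⌋₊ - 1 : ℝ) < ⌊u / h⌋₊ + 1 := lt_of_mul_lt_mul_right (hus.1.trans huhi) hh.le
  generalize ⌊u / h⌋₊ = k at *
  generalize ⌊s / h⌋₊ = j at *
  rw [sub_lt_iff_lt_add] at hge
  norm_cast at hle hge
  obtain rfl | rfl : k = j ∨ j = k + 1 := by lia
  · exact EventuallyEq.rfl
  push_cast at hus
  have hsucc := hX.eqOn_succ k <| by
    simpa only [mem_ball] using hnear k (↑(k + 1) * h) (by positivity)
      (by push_cast; rw [add_mul, one_mul, add_sub_cancel_left, abs_of_pos hh])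
  have hu1 : γ u ∈ ball (γ (↑(k + 1) * h)) κ :=
    hnear (k + 1) u hu (by push_cast; exact abs_le.2 ⟨by linarith, by linarith⟩)
  have hu0 : γ u ∈ ball (γ (k * h)) κ := hnear k u hu (abs_le.2 ⟨by linarith, by linarith⟩)
  exact (hsucc.eventuallyEq_of_mem ((isOpen_ball.inter isOpen_ball).mem_nhds ⟨hu1, hu0⟩)).symm

variable {Ω : DFS} {f : ℂ → ℂ}

theorem continuableAlong_of_chainCont (hf : ∀ Λ, ChainCont Ω.realGraph f Λ) {γ : LipPath}
    (hγ : γ.IsAllowed Ω) : ContinuableAlong f γ := by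
  obtain ⟨ε, hε, hm⟩ := hγ.exists_margin
  obtain ⟨κ, hκ, hmesh⟩ := hf (γ.lengthUpTo γ.tEnd) ε hε
  obtain ⟨K, hK⟩ := γ.lipschitz
  obtain ⟨h, hh, hKh⟩ : ∃ h > 0, K * h < κ := by
    refine ⟨κ / (K + 1), by positivity, ?_⟩
    rw [mul_div_assoc', div_lt_iff₀ (by positivity)]
    linarith
  have hT := γ.tEnd_nonneg
  have hmaps : MapsTo (fun s => min s γ.tEnd) (Ici 0) (Icc 0 γ.tEnd) := fun s hs =>
    ⟨le_min hs hT, min_le_right _ _⟩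
  let t : ℕ → ℝ := fun j => min (j * h) γ.tEnd
  have ht : ∀ j, t j ∈ Icc 0 γ.tEnd := fun j => hmaps (mem_Ici.2 (by positivity))
  have hmono : Monotone t := fun i j hij => min_le_min_right _ (by gcongr)
  have hstep : ∀ j, t (j + 1) - t j ≤ h := fun j => by
    refine (le_abs_self _).trans ((abs_min_sub_min_le_max _ _ _ _).trans ?_)
    rw [Nat.cast_succ, add_mul, one_mul, add_sub_cancel_left, sub_self, abs_zero, abs_of_pos hh,
      max_eq_left hh.le]
  have hlen : ∀ j, (γ.lengthUpTo (t (j + 1)) : ℝ) - γ.lengthUpTo (t j) < κ := fun j =>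
    ((LipPath.lengthUpTo_sub_le (ht j).1 (hmono j.le_succ) (ht _).2
      (hK.mono (Icc_subset_Icc (ht j).1 (ht _).2))).trans
        (mul_le_mul_of_nonneg_left (hstep j) K.coe_nonneg)).trans_lt hKh
  obtain ⟨X, hX⟩ := hmesh _ (LipPath.isChain hmono (by simp [t, hT]) fun j => (ht j).2) hlen
    (fun j => hm _ (ht j)) (fun j => LipPath.lengthUpTo_mono (ht j).1 (ht j).2 le_rfl)
  have hlip : LipschitzOnWith K (fun s => γ.toFun (min s γ.tEnd)) (Ici 0) := by
    rw [← mul_one K]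
    exact hK.comp (LipschitzWith.id.min_const γ.tEnd).lipschitzOnWith hmaps
  refine continuableAlong_iff.2 ⟨_, ((hX.germCont hh hKh hlip).mono Icc_subset_Ici_self).congr
    fun s hs => congrArg γ.toFun (min_eq_left hs.2), ?_⟩
  rw [zero_div, Nat.floor_zero]
  exact hX.start

end PathOfChain

section SumsOfDFS

theorem DFS.realGraph_mono {Ω Ω' : DFS} (h : ∀ L, Ω.carrier L ⊆ Ω'.carrier L) :
    Ω.realGraph ⊆ Ω'.realGraph :=
  image_mono fun p hp => h p.1 hp

theorem DFS.realGraph_subset_prod {ι : Type*} (Ω : ι → DFS) {s : Finset ι} {i : ι} (hi : i ∈ s) :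
    (Ω i).realGraph ⊆ (∏ i ∈ s, Ω i).realGraph := by
  obtain ⟨Ω', h⟩ := Finset.dvd_prod_of_mem Ω hi
  rw [h]
  exact DFS.realGraph_mono fun L ω hω => DFS.mem_mul.2 (Or.inr (Or.inl hω))

theorem DFS.realGraph_subset_iterSum (Ω : DFS) : Ω.realGraph ⊆ Ω.iterSum.realGraph :=
  DFS.realGraph_mono fun L ω hω => mem_iUnion.2 ⟨0, by rwa [zero_add, pow_one]⟩

theorem DFS.add_mem_realGraph_iterSum (Ω : DFS) {s t : ℝ × ℂ} (hs : s ∈ Ω.realGraph)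
    (ht : t ∈ Ω.iterSum.realGraph) : s + t ∈ Ω.iterSum.realGraph := by
  obtain ⟨⟨L, ω⟩, hω, rfl⟩ := hs
  obtain ⟨⟨L', ω'⟩, hω', rfl⟩ := ht
  obtain ⟨n, hn⟩ := mem_iUnion.1 hω'
  refine DFS.mem_realGraph (L := L + L') (mem_iUnion.2 ⟨n + 1, ?_⟩)
  rw [pow_succ', DFS.mem_mul]
  exact Or.inl ⟨L, L', rfl, ω, hω, ω', hn, rfl⟩

theorem DFS.exists_le_of_mem_realGraph (Ω : DFS) : ∃ δ > 0, ∀ s ∈ Ω.realGraph, δ ≤ s.1 := by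
  obtain ⟨δ, hδ, he⟩ := Ω.empty'
  refine ⟨δ, hδ, ?_⟩
  rintro _ ⟨⟨L, ω⟩, hω, rfl⟩
  by_contra! hlt
  have hmem := Ω.mono' L δ (NNReal.coe_le_coe.1 hlt.le) hω
  rwa [he] at hmem

end SumsOfDFS

section ChainContOperations

variable {E F : Type*} [NormedAddCommGroup E] [NormedSpace ℂ E] [NormedAddCommGroup F]
  [NormedSpace ℂ F] {S : Set (ℝ × ℂ)} {Λ : ℝ}

theorem ChainCont.map {f : ℂ → E} (h : ChainCont S f Λ) (T : E →L[ℂ] F) :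
    ChainCont S (fun z => T (f z)) Λ := by
  intro ε hε
  obtain ⟨κ, hκ, hmesh⟩ := h ε hε
  refine ⟨κ, hκ, fun p hp hs hm hl => ?_⟩
  obtain ⟨X, hX⟩ := hmesh p hp hs hm hl
  exact ⟨fun j z => T (X j z), fun j => T.differentiable.comp_differentiableOn (hX.diff j),
    hX.start.fun_comp T, fun j => (hX.step j).fun_comp T⟩

theorem ChainCont.add {f g : ℂ → E} (hf : ChainCont S f Λ) (hg : ChainCont S g Λ) :
    ChainCont S (fun z => f z + g z) Λ := by
  intro ε hε
  obtain ⟨κ, hκ, hmesh⟩ := hf ε hε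
  obtain ⟨κ', hκ', hmesh'⟩ := hg ε hε
  refine ⟨min κ κ', lt_min hκ hκ', fun p hp hs hm hl => ?_⟩
  obtain ⟨X, hX⟩ := hmesh p hp (fun j => (hs j).trans_le (min_le_left _ _)) hm hl
  obtain ⟨Y, hY⟩ := hmesh' p hp (fun j => (hs j).trans_le (min_le_right _ _)) hm hl
  have hX := hX.mono (min_le_left κ κ')
  have hY := hY.mono (min_le_right κ κ')
  exact ⟨fun j z => X j z + Y j z, fun j => (hX.diff j).add (hY.diff j), hX.start.add hY.start,
    fun j => (hX.step j).add (hY.step j)⟩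

theorem ChainCont.zero : ChainCont S (fun _ => (0 : E)) Λ := fun _ _ =>
  ⟨1, one_pos, fun _ _ _ _ _ => ⟨fun _ _ => 0, fun _ => differentiableOn_const _,
    EventuallyEq.rfl, fun _ => EventuallyEq.rfl⟩⟩

theorem ChainCont.sum {ι : Type*} {s : Finset ι} {f : ι → ℂ → E}
    (h : ∀ i ∈ s, ChainCont S (f i) Λ) : ChainCont S (fun z => ∑ i ∈ s, f i z) Λ := by
  classical
  induction s using Finset.induction_on with
  | empty => simpa only [Finset.sum_empty] using ChainCont.zero
  | insert i s hi ih =>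
    simp only [Finset.sum_insert hi]
    exact (h i (Finset.mem_insert_self i s)).add
      (ih fun j hj => h j (Finset.mem_insert_of_mem hj))

end ChainContOperations

section ConvolutionGerms

variable {A : Type*} [NormedRing A] [NormedAlgebra ℂ A] [CompleteSpace A] {X V f : ℂ → A} {c : ℂ}

theorem exists_common_ball (hX : AnalyticAt ℂ X c) (hV : AnalyticAt ℂ V 0) :
    ∃ R > 0, DifferentiableOn ℂ X (ball c R) ∧ DifferentiableOn ℂ V (ball 0 R) := by
  obtain ⟨r, hr, hXr⟩ := exists_differentiableOn_ball hX
  obtain ⟨s, hs, hVs⟩ := exists_differentiableOn_ball hV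
  exact ⟨min r s, lt_min hr hs, hXr.mono (ball_subset_ball (min_le_left _ _)),
    hVs.mono (ball_subset_ball (min_le_right _ _))⟩

theorem analyticAt_convFrom (hX : AnalyticAt ℂ X c) (hV : AnalyticAt ℂ V 0) :
    AnalyticAt ℂ (convFrom c X V) c := by
  obtain ⟨R, hR, hXR, hVR⟩ := exists_common_ball hX hV
  exact (differentiableOn_convFrom hXR hVR).analyticAt (ball_mem_nhds c hR)

theorem deriv_convFrom_eventuallyEq (hX : AnalyticAt ℂ X c) (hV : AnalyticAt ℂ V 0) :
    deriv (convFrom c X V) =ᶠ[𝓝 c] fun z => X z * V 0 + convFrom c X (deriv V) z := by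
  obtain ⟨R, hR, hXR, hVR⟩ := exists_common_ball hX hV
  filter_upwards [ball_mem_nhds c hR] with z hz using (hasDerivAt_convFrom hXR hVR hz).deriv

-- Convolution with `X` is multiplication of Taylor data on the side of the formal series; the
-- extra term `a 0 * V z` stands for the unit of the convolution with coefficient `a 0`.
theorem iteratedDeriv_mul_add_convFrom {a : ℕ → A} (hX : AnalyticAt ℂ X 0)
    (hV : AnalyticAt ℂ V 0) (n : ℕ) (ha : ∀ k < n, iteratedDeriv k X 0 = a (k + 1)) :
    iteratedDeriv n (fun z => a 0 * V z + convFrom 0 X V z) 0 =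
      ∑ p ∈ Finset.HasAntidiagonal.antidiagonal n, a p.1 * iteratedDeriv p.2 V 0 := by
  induction n generalizing V with
  | zero => simp [convFrom_self]
  | succ n ih =>
    have hderiv : deriv (fun z => a 0 * V z + convFrom 0 X V z) =ᶠ[𝓝 0]
        fun z => X z * V 0 + (a 0 * deriv V z + convFrom 0 X (deriv V) z) := by
      filter_upwards [deriv_convFrom_eventuallyEq hX hV, hV.eventually_analyticAt,
        (analyticAt_convFrom hX hV).eventually_analyticAt] with z hconv hVz hcz
      rw [deriv_fun_add (hVz.differentiableAt.const_mul _) hcz.differentiableAt, hconv,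
        deriv_const_mul _ hVz.differentiableAt, add_left_comm]
    have hmul : AnalyticAt ℂ (fun z => X z * V 0) 0 := hX.mul analyticAt_const
    have hrest : AnalyticAt ℂ (fun z => a 0 * deriv V z + convFrom 0 X (deriv V) z) 0 :=
      (analyticAt_const.mul hV.deriv).add (analyticAt_convFrom hX hV.deriv)
    have hconst : iteratedDeriv n (fun z => X z * V 0) 0 = a (n + 1) * V 0 := by
      simpa only [smul_eq_mul, ha n n.lt_succ_self] using
        iteratedDeriv_smul_const (n := n) hX.contDiffAt (V 0)
    rw [iteratedDeriv_succ', hderiv.iteratedDeriv_eq,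
      iteratedDeriv_fun_add hmul.contDiffAt hrest.contDiffAt,
      hconst, ih hV.deriv fun k hk => ha k (hk.trans n.lt_succ_self),
      Finset.Nat.sum_antidiagonal_succ', iteratedDeriv_zero]
    simp only [iteratedDeriv_succ']

theorem map_convFrom_eq_sum {B ι : Type*} [NormedRing B] [NormedAlgebra ℂ B] [CompleteSpace B]
    {s : Finset ι} {x v : ι → ℂ → B} {R : ℝ} (hX : ContinuousOn X (ball c R))
    (hV : ContinuousOn V (ball 0 R)) (hx : ∀ i ∈ s, ContinuousOn (x i) (ball c R))
    (hv : ∀ i ∈ s, ContinuousOn (v i) (ball 0 R)) {T : A →L[ℂ] B}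
    (hT : ∀ u w, T (X u * V w) = ∑ i ∈ s, x i u * v i w) {z : ℂ} (hz : z ∈ ball c R) :
    T (convFrom c X V z) = ∑ i ∈ s, convFrom c (x i) (v i) z := by
  simp only [convFrom_eq_integral_convKernel]
  rw [← T.intervalIntegral_comp_comm (intervalIntegrable_smul_convKernel hX hV hz),
    ← intervalIntegral.integral_finsetSum fun i hi =>
      intervalIntegrable_smul_convKernel (hx i hi) (hv i hi) hz]
  simp only [convKernel, map_smul, hT, Finset.smul_sum]

theorem exists_resolvent (hf : AnalyticAt ℂ f 0) :
    ∃ χ : ℂ → A, AnalyticAt ℂ χ 0 ∧ ∀ᶠ z in 𝓝 0, χ z = f z + convFrom 0 χ f z := by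
  obtain ⟨κ, hκ, -, -, hfd, M, hM, hκM⟩ := exists_radius_forall_differentiableOn hf hf one_pos
  obtain ⟨χ, hχ, heq⟩ := exists_volterra hfd hfd hM hκM
  exact ⟨χ, hχ.analyticAt (ball_mem_nhds 0 hκ), eventually_of_mem (ball_mem_nhds 0 hκ) heq⟩

theorem ChainCont.exists_resolvent {S T : Set (ℝ × ℂ)} {δ : ℝ} (hδ : 0 < δ)
    (hS : ∀ s ∈ S, δ ≤ s.1) (hST : S ⊆ T) (hadd : ∀ s ∈ S, ∀ t ∈ T, s + t ∈ T)
    (hf : AnalyticAt ℂ f 0) (hcont : ∀ Λ, ChainCont S f Λ) :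
    ∃ χ : ℂ → A, AnalyticAt ℂ χ 0 ∧ (∀ᶠ z in 𝓝 0, χ z = f z + convFrom 0 χ f z) ∧
      ∀ Λ, ChainCont T χ Λ := by
  obtain ⟨χ, hχ0, hχ⟩ := Resurgence.exists_resolvent hf
  exact ⟨χ, hχ0, hχ, ChainCont.resolvent hδ hS hST hadd hf hχ0 hχ hcont⟩

end ConvolutionGerms

section BorelTransform

theorem hasFPowerSeriesAt_borel_iff {f : ℂ → ℂ} {φ : PowerSeries ℂ} :
    HasFPowerSeriesAt f
        (FormalMultilinearSeries.ofScalars ℂ fun n => PowerSeries.coeff n (borel φ).2) 0 ↔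
      AnalyticAt ℂ f 0 ∧ ∀ n, iteratedDeriv n f 0 = PowerSeries.coeff (n + 1) φ := by
  have hcoeff : ∀ n, PowerSeries.coeff n (borel φ).2 =
      PowerSeries.coeff (n + 1) φ / (n.factorial : ℂ) := fun n => by
    rw [borel, PowerSeries.coeff_mk]
  have hfac : ∀ n : ℕ, (n.factorial : ℂ) ≠ 0 := fun n => Nat.cast_ne_zero.2 n.factorial_ne_zero
  simp only [hcoeff]
  refine ⟨fun h => ⟨h.analyticAt, fun n => ?_⟩, fun ⟨hf, hn⟩ => ?_⟩
  · have huniq := h.analyticAt.hasFPowerSeriesAt.eq_formalMultilinearSeries h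
    rw [FormalMultilinearSeries.ofScalars_series_eq_iff] at huniq
    exact (div_left_inj' (hfac n)).1 (congrFun huniq n)
  · simpa only [hn] using hf.hasFPowerSeriesAt

end BorelTransform

section Coefficients

variable {σ : Type*} {t : ℂ}

/-- The space of bounded families indexed by the monomials in the variables `σ`. -/
abbrev CoeffSpace (σ : Type*) : Type _ := lp (fun _ : σ →₀ ℕ => ℂ) ⊤

/-- The linear form on bounded operators that applies an operator to the family `b` and extracts
the entry of the result at the monomial `1`. -/
def constantEntry (b : CoeffSpace σ) : (CoeffSpace σ →L[ℂ] CoeffSpace σ) →L[ℂ] ℂ :=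
  (lp.evalCLM ℂ (fun _ : σ →₀ ℕ => ℂ) ⊤ 0).comp (ContinuousLinearMap.apply ℂ (CoeffSpace σ) b)

theorem constantEntry_apply (b : CoeffSpace σ) (T : CoeffSpace σ →L[ℂ] CoeffSpace σ) :
    constantEntry b T = T b 0 := rfl

/-- The power series with coefficients `b m * t ^ |m|`; every convergent power series has this form,
with `b` bounded. -/
def toSeries (t : ℂ) (b : (σ →₀ ℕ) → ℂ) : MvPowerSeries σ ℂ := fun m => b m * t ^ m.degree

theorem coeff_toSeries (t : ℂ) (b : (σ →₀ ℕ) → ℂ) (m : σ →₀ ℕ) :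
    MvPowerSeries.coeff m (toSeries t b) = b m * t ^ m.degree := rfl

theorem IsConvergent.exists_toSeries_eq {r : ℕ} {F : MvPowerSeries (Fin r) ℂ}
    (hF : IsConvergent F) : ∃ (t : ℂ) (b : CoeffSpace (Fin r)), toSeries t b = F := by
  obtain ⟨ρ, hρ, hsum⟩ := hF
  refine ⟨(ρ : ℂ)⁻¹, ⟨fun m => MvPowerSeries.coeff m F * (ρ : ℂ) ^ m.degree, memℓp_infty
    ⟨∑' k : Fin r →₀ ℕ, ‖MvPowerSeries.coeff k F‖ * ρ ^ k.degree, ?_⟩⟩, ?_⟩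
  · rintro _ ⟨m, rfl⟩
    beta_reduce
    rw [norm_mul, norm_pow, Complex.norm_real, Real.norm_of_nonneg hρ.le]
    exact hsum.le_tsum m fun k _ => by positivity
  · ext m
    rw [coeff_toSeries, mul_assoc, ← mul_pow, mul_inv_cancel₀ (Complex.ofReal_ne_zero.2 hρ.ne'),
      one_pow, mul_one]

variable [LinearOrder σ] {i : σ} {b : CoeffSpace σ} {m : σ →₀ ℕ}

open Classical in
/-- Let `G i` be the part of the power series `toSeries t b` consisting of the monomials whose first
variable is the `i`-th one; the family of coefficients of `G i / X i` is `shiftFun t i b`. -/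
def shiftFun (t : ℂ) (i : σ) (b : (σ →₀ ℕ) → ℂ) (m : σ →₀ ℕ) : ℂ :=
  if IsLeast ((m + Finsupp.single i 1).support : Set σ) i then t * b (m + Finsupp.single i 1) else 0

theorem norm_shiftFun_le (t : ℂ) (i : σ) (b : CoeffSpace σ) (m : σ →₀ ℕ) :
    ‖shiftFun t i b m‖ ≤ ‖t‖ * ‖b‖ := by
  rw [shiftFun]
  split_ifs
  · rw [norm_mul]
    exact mul_le_mul_of_nonneg_left (lp.norm_apply_le_norm ENNReal.top_ne_zero b _) (norm_nonneg t)
  · rw [norm_zero]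
    positivity

/-- The map `shiftFun` as a bounded operator. -/
def shift (t : ℂ) (i : σ) : CoeffSpace σ →L[ℂ] CoeffSpace σ :=
  LinearMap.mkContinuous
    { toFun := fun b => ⟨shiftFun t i b, memℓp_infty ⟨‖t‖ * ‖b‖, by
        rintro _ ⟨m, rfl⟩
        exact norm_shiftFun_le t i b m⟩⟩
      map_add' := fun a b => by
        ext m
        simp only [lp.coeFn_add, Pi.add_apply, shiftFun]
        split_ifs <;> ring
      map_smul' := fun c b => by
        ext m
        simp only [lp.coeFn_smul, Pi.smul_apply, shiftFun, smul_eq_mul, RingHom.id_apply]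
        split_ifs <;> ring } ‖t‖ fun b =>
    lp.norm_le_of_forall_le (by positivity) fun m => norm_shiftFun_le t i b m

theorem shift_apply (t : ℂ) (i : σ) (b : CoeffSpace σ) (m : σ →₀ ℕ) :
    shift t i b m = shiftFun t i b m := rfl

theorem coeff_X_mul_toSeries_shift_of_isLeast (hi : IsLeast (m.support : Set σ) i) :
    MvPowerSeries.coeff m (MvPowerSeries.X i * toSeries t (shift t i b)) =
      MvPowerSeries.coeff m (toSeries t b) := by
  have hle : Finsupp.single i 1 ≤ m :=
    Finsupp.single_le_iff.2 (Nat.one_le_iff_ne_zero.2 (Finsupp.mem_support_iff.1 hi.1))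
  obtain ⟨n, rfl⟩ := exists_add_of_le hle
  rw [MvPowerSeries.X, MvPowerSeries.coeff_add_monomial_mul, one_mul, coeff_toSeries,
    coeff_toSeries, shift_apply, shiftFun, add_comm n, if_pos hi, map_add, Finsupp.degree_single,
    pow_add, pow_one]
  ring

theorem coeff_X_mul_toSeries_shift_of_not_isLeast (hi : ¬ IsLeast (m.support : Set σ) i) :
    MvPowerSeries.coeff m (MvPowerSeries.X i * toSeries t (shift t i b)) = 0 := by
  rw [MvPowerSeries.X, MvPowerSeries.coeff_monomial_mul]
  split_ifs with hle
  · rw [coeff_toSeries, shift_apply, shiftFun, tsub_add_cancel_of_le hle, if_neg hi, zero_mul,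
      mul_zero]
  · rfl

theorem toSeries_eq_C_add_sum [Fintype σ] (t : ℂ) (b : CoeffSpace σ) :
    toSeries t b =
      MvPowerSeries.C (b 0) + ∑ i, MvPowerSeries.X i * toSeries t (shift t i b) := by
  ext m
  rw [map_add, map_sum, MvPowerSeries.coeff_C]
  rcases eq_or_ne m 0 with rfl | hm
  · simp [coeff_toSeries]
  have hleast := m.support.isLeast_min' (Finsupp.support_nonempty_iff.2 hm)
  rw [if_neg hm, zero_add, Finset.sum_eq_single_of_mem _ (Finset.mem_univ _) fun i _ hi =>
    coeff_X_mul_toSeries_shift_of_not_isLeast fun h => hi (h.unique hleast),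
    coeff_X_mul_toSeries_shift_of_isLeast hleast]

variable {φ : σ → PowerSeries ℂ}

theorem subst_toSeries [Fintype σ] (t : ℂ) (b : CoeffSpace σ)
    (hφ : ∀ i, PowerSeries.constantCoeff (φ i) = 0) :
    (MvPowerSeries.subst φ (toSeries t b) : PowerSeries ℂ) =
      PowerSeries.C (b 0) + ∑ i, φ i * MvPowerSeries.subst φ (toSeries t (shift t i b)) := by
  have hsubst : MvPowerSeries.HasSubst φ := MvPowerSeries.hasSubst_of_constantCoeff_zero hφ
  conv_lhs => rw [toSeries_eq_C_add_sum, ← MvPowerSeries.substAlgHom_apply (R := ℂ) hsubst,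
    map_add, map_sum, MvPowerSeries.substAlgHom_apply, MvPowerSeries.subst_C]
  refine congrArg _ (Finset.sum_congr rfl fun i _ => ?_)
  rw [map_mul, MvPowerSeries.substAlgHom_X, MvPowerSeries.substAlgHom_apply]

theorem coeff_zero_subst_toSeries [Finite σ] (t : ℂ) (b : CoeffSpace σ)
    (hφ : ∀ i, PowerSeries.constantCoeff (φ i) = 0) :
    PowerSeries.coeff 0 (MvPowerSeries.subst φ (toSeries t b) : PowerSeries ℂ) = b 0 := by
  have := Fintype.ofFinite σ
  rw [subst_toSeries t b hφ]
  simp [hφ]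

theorem coeff_succ_subst_toSeries [Fintype σ] (t : ℂ) (b : CoeffSpace σ)
    (hφ : ∀ i, PowerSeries.constantCoeff (φ i) = 0) (n : ℕ) :
    PowerSeries.coeff (n + 1) (MvPowerSeries.subst φ (toSeries t b) : PowerSeries ℂ) =
      ∑ i, ∑ p ∈ Finset.HasAntidiagonal.antidiagonal n, PowerSeries.coeff p.1
        (MvPowerSeries.subst φ (toSeries t (shift t i b)) : PowerSeries ℂ) *
          PowerSeries.coeff (p.2 + 1) (φ i) := by
  rw [subst_toSeries t b hφ, map_add, PowerSeries.coeff_C, if_neg n.succ_ne_zero, zero_add,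
    map_sum]
  refine Finset.sum_congr rfl fun i _ => ?_
  rw [mul_comm, PowerSeries.coeff_mul, Finset.Nat.sum_antidiagonal_succ',
    PowerSeries.coeff_zero_eq_constantCoeff_apply (φ i), hφ, mul_zero, zero_add]

end Coefficients

section Resolvent

variable {σ : Type*} [LinearOrder σ] [Fintype σ] {t : ℂ} {f : σ → ℂ → ℂ}
  {χ : ℂ → CoeffSpace σ →L[ℂ] CoeffSpace σ} {S T : Set (ℝ × ℂ)} {δ : ℝ}

/-- The operator-valued germ `∑ i, f i z • shift t i`, whose resolvent encodes the Borel transforms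
of all the series `F(φ)`, when `f i` is the Borel transform of `φ i`. -/
def genFun (t : ℂ) (f : σ → ℂ → ℂ) (z : ℂ) : CoeffSpace σ →L[ℂ] CoeffSpace σ :=
  ∑ i, f i z • shift t i

theorem genFun_apply (t : ℂ) (f : σ → ℂ → ℂ) (z : ℂ) (b : CoeffSpace σ) :
    genFun t f z b = ∑ i, f i z • shift t i b := by
  simp only [genFun, sum_apply, smul_apply]

theorem analyticAt_genFun (t : ℂ) (hf : ∀ i, AnalyticAt ℂ (f i) 0) :
    AnalyticAt ℂ (genFun t f) 0 :=
  Finset.analyticAt_fun_sum _ fun i _ => (hf i).smul analyticAt_const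

theorem chainCont_genFun {Λ : ℝ} (t : ℂ) (hf : ∀ i, ChainCont S (f i) Λ) :
    ChainCont S (genFun t f) Λ :=
  ChainCont.sum fun i _ => (hf i).map ((ContinuousLinearMap.id ℂ ℂ).smulRight (shift t i))

theorem constantEntry_mul_genFun (t : ℂ) (f : σ → ℂ → ℂ) (z : ℂ)
    (T : CoeffSpace σ →L[ℂ] CoeffSpace σ) (b : CoeffSpace σ) :
    constantEntry b (T * genFun t f z) = ∑ i, constantEntry (shift t i b) T * f i z := by
  simp only [constantEntry_apply, mul_apply_eq_comp, genFun_apply, map_sum, map_smul,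
    lp.coeFn_sum, lp.coeFn_smul, Finset.sum_apply, Pi.smul_apply, smul_eq_mul, mul_comm (f _ z)]

theorem constantEntry_convFrom_genFun (hf : ∀ i, AnalyticAt ℂ (f i) 0) (hχ : AnalyticAt ℂ χ 0)
    (b : CoeffSpace σ) :
    ∀ᶠ z in 𝓝 0, constantEntry b (convFrom 0 χ (genFun t f) z) =
      ∑ i, convFrom 0 (fun u => constantEntry (shift t i b) (χ u)) (f i) z := by
  obtain ⟨R, hR, hd⟩ := exists_differentiableOn_ball (hχ.prod (analyticAt_pi_iff.2 hf))
  have hχc : ContinuousOn χ (ball 0 R) := hd.fst.continuousOn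
  have hfc : ∀ i, ContinuousOn (f i) (ball 0 R) := fun i =>
    (differentiableOn_pi.1 hd.snd i).continuousOn
  have hgen : ContinuousOn (genFun t f) (ball 0 R) :=
    continuousOn_finsetSum _ fun i _ => (hfc i).smul continuousOn_const
  have hentry : ∀ i ∈ Finset.univ,
      ContinuousOn (fun u => constantEntry (shift t i b) (χ u)) (ball 0 R) := fun i _ =>
    (constantEntry _).continuous.comp_continuousOn hχc
  filter_upwards [ball_mem_nhds 0 hR] with z hz
  exact map_convFrom_eq_sum hχc hgen hentry (fun i _ => hfc i)
    (fun u w => constantEntry_mul_genFun t f w (χ u) b) hz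

theorem constantEntry_resolvent (hf : ∀ i, AnalyticAt ℂ (f i) 0) (hχ0 : AnalyticAt ℂ χ 0)
    (hχ : ∀ᶠ z in 𝓝 0, χ z = genFun t f z + convFrom 0 χ (genFun t f) z) (b : CoeffSpace σ) :
    (fun z => constantEntry b (χ z)) =ᶠ[𝓝 0] fun z => ∑ i, (shift t i b 0 * f i z +
      convFrom 0 (fun u => constantEntry (shift t i b) (χ u)) (f i) z) := by
  filter_upwards [hχ, constantEntry_convFrom_genFun hf hχ0 b] with z hz hconv
  have hgen : constantEntry b (genFun t f z) = ∑ i, shift t i b 0 * f i z := by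
    rw [← one_mul (genFun t f z), constantEntry_mul_genFun]
    rfl
  rw [hz, map_add, hconv, hgen, ← Finset.sum_add_distrib]

theorem iteratedDeriv_constantEntry_resolvent {φ : σ → PowerSeries ℂ}
    (hφ0 : ∀ i, PowerSeries.constantCoeff (φ i) = 0) (hf : ∀ i, AnalyticAt ℂ (f i) 0)
    (hfφ : ∀ i n, iteratedDeriv n (f i) 0 = PowerSeries.coeff (n + 1) (φ i))
    (hχ0 : AnalyticAt ℂ χ 0)
    (hχ : ∀ᶠ z in 𝓝 0, χ z = genFun t f z + convFrom 0 χ (genFun t f) z) (b : CoeffSpace σ)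
    (n : ℕ) : iteratedDeriv n (fun z => constantEntry b (χ z)) 0 =
      PowerSeries.coeff (n + 1) (MvPowerSeries.subst φ (toSeries t b) : PowerSeries ℂ) := by
  induction n using Nat.strong_induction_on generalizing b with | _ n ih =>
  have hentry : ∀ c, AnalyticAt ℂ (fun z => constantEntry c (χ z)) 0 := fun c =>
    ((constantEntry c).analyticAt _).comp hχ0
  have hterm : ∀ i, AnalyticAt ℂ (fun z => shift t i b 0 * f i z +
      convFrom 0 (fun u => constantEntry (shift t i b) (χ u)) (f i) z) 0 := fun i =>
    (analyticAt_const.mul (hf i)).add (analyticAt_convFrom (hentry _) (hf i))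
  rw [(constantEntry_resolvent hf hχ0 hχ b).iteratedDeriv_eq,
    iteratedDeriv_fun_sum fun i _ => (hterm i).contDiffAt, coeff_succ_subst_toSeries t b hφ0]
  refine Finset.sum_congr rfl fun i _ => ?_
  rw [← coeff_zero_subst_toSeries t (shift t i b) hφ0]
  simp only [← hfφ]
  exact iteratedDeriv_mul_add_convFrom (a := fun k => PowerSeries.coeff k
    (MvPowerSeries.subst φ (toSeries t (shift t i b)) : PowerSeries ℂ)) (hentry _) (hf i) n
    fun k hk => ih k hk _

theorem exists_chainCont_resolvent_genFun (hδ : 0 < δ) (hS : ∀ s ∈ S, δ ≤ s.1) (hST : S ⊆ T)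
    (hadd : ∀ s ∈ S, ∀ t ∈ T, s + t ∈ T) (t : ℂ) (hf : ∀ i, AnalyticAt ℂ (f i) 0)
    (hcont : ∀ i Λ, ChainCont S (f i) Λ) :
    ∃ χ : ℂ → CoeffSpace σ →L[ℂ] CoeffSpace σ, AnalyticAt ℂ χ 0 ∧
      (∀ᶠ z in 𝓝 0, χ z = genFun t f z + convFrom 0 χ (genFun t f) z) ∧
        ∀ Λ, ChainCont T χ Λ := by
  have hgen : AnalyticAt ℂ (genFun t f) 0 := analyticAt_genFun t hf
  have hgencont : ∀ Λ, ChainCont S (genFun t f) Λ := fun Λ => chainCont_genFun t fun i => hcont i Λ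
  exact ChainCont.exists_resolvent hδ hS hST hadd hgen hgencont

end Resolvent

theorem exists_chainCont_borel_subst {σ : Type*} [LinearOrder σ] [Finite σ] {S T : Set (ℝ × ℂ)}
    {δ : ℝ} (hδ : 0 < δ) (hS : ∀ s ∈ S, δ ≤ s.1) (hST : S ⊆ T)
    (hadd : ∀ s ∈ S, ∀ t ∈ T, s + t ∈ T) {φ : σ → PowerSeries ℂ} {f : σ → ℂ → ℂ}
    (hφ0 : ∀ i, PowerSeries.constantCoeff (φ i) = 0) (hf : ∀ i, AnalyticAt ℂ (f i) 0)
    (hfφ : ∀ i n, iteratedDeriv n (f i) 0 = PowerSeries.coeff (n + 1) (φ i))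
    (hcont : ∀ i Λ, ChainCont S (f i) Λ) (t : ℂ) (b : CoeffSpace σ) :
    ∃ g : ℂ → ℂ, AnalyticAt ℂ g 0 ∧ (∀ n, iteratedDeriv n g 0 =
      PowerSeries.coeff (n + 1) (MvPowerSeries.subst φ (toSeries t b) : PowerSeries ℂ)) ∧
        ∀ Λ, ChainCont T g Λ := by
  have := Fintype.ofFinite σ
  obtain ⟨χ, hχ0, hχ, hres⟩ := exists_chainCont_resolvent_genFun hδ hS hST hadd t hf hcont
  exact ⟨fun z => constantEntry b (χ z), ((constantEntry b).analyticAt _).comp hχ0,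
    iteratedDeriv_constantEntry_resolvent hφ0 hf hfφ hχ0 hχ b,
    fun Λ => (hres Λ).map (constantEntry b)⟩

end Resurgence

end

theorem theorem2 (r : ℕ) (hr : 1 ≤ r) (Ω : Fin r → Resurgence.DFS)
    (F : MvPowerSeries (Fin r) ℂ) (hF : Resurgence.IsConvergent F)
    (φ : Fin r → PowerSeries ℂ) (hφ₀ : ∀ i, PowerSeries.constantCoeff (φ i) = 0)
    (hφ : ∀ i, φ i ∈ Resurgence.resurgent (Ω i)) :
    (MvPowerSeries.subst φ F : PowerSeries ℂ) ∈
      Resurgence.resurgent (Resurgence.DFS.iterSum (∏ i, Ω i)) := by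
  obtain ⟨t, b, rfl⟩ := hF.exists_toSeries_eq
  choose f hf hcont using fun i => (hφ i).2
  choose hf₀ hfφ using fun i => Resurgence.hasFPowerSeriesAt_borel_iff.1 (hf i)
  have hchain : ∀ i Λ, Resurgence.ChainCont (∏ i, Ω i).realGraph (f i) Λ := fun i Λ =>
    (Resurgence.chainCont_of_continuableAlong (hf₀ i) (hcont i) Λ).mono
      (Resurgence.DFS.realGraph_subset_prod Ω (Finset.mem_univ i)) le_rfl
  obtain ⟨δ, hδ, hle⟩ := (∏ i, Ω i).exists_le_of_mem_realGraph
  obtain ⟨g, hg₀, hgφ, hg⟩ := Resurgence.exists_chainCont_borel_subst hδ hle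
    (∏ i, Ω i).realGraph_subset_iterSum
    (fun s hs t ht => (∏ i, Ω i).add_mem_realGraph_iterSum hs ht) hφ₀ hf₀ hfφ hchain t b
  exact ⟨Set.mem_univ _, g, Resurgence.hasFPowerSeriesAt_borel_iff.2 ⟨hg₀, hgφ⟩,
    fun γ hγ => Resurgence.continuableAlong_of_chainCont hg hγ⟩
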